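/- **Definitions.** A $\lambda$-ring is a commutative ring $R$ with operations $\lambda^n:R\to R$ ($n\ge 0$) such that $\lambda^0(x)=1$, $\lambda^1(x)=x$, $\lambda^n(x+y)=\sum_{r=0}^n\lambda^r(x)\lambda^{n-r}(y)$; put $\lambda_t(x)=\sum_n\lambda^n(x)t^n$. It is *special* if $\lambda_t:R\to\Lambda(R)$ is a ring homomorphism commuting with the $\lambda$-operations. Here $\Lambda(R)=1+tR[[t]]$, whose addition is multiplication of power series, whose unit is $1+t$, whose multiplication is $(1+\sum a_nt^n)\star(1+\sum b_nt^n)=1+\sum P_n(a_1,\dots,a_n;b_1,\dots,b_n)t^n$, and whose $\lambda$-operations are $\Lambda^m(1+\sum a_nt^n)=1+\sum P_{n,m}(a_1,\dots,a_{nm})t^n$. The integral polynomials $P_n$ and $P_{n,m}$ express the coefficients of $t^n$ in $\prod_{i,j}(1+x_iy_jt)$ and in $\prod_{i_1<\dots<i_m}(1+x_{i_1}\cdots x_{i_m}t)$ through the elementary symmetric functions of the $x_i$ and of the $y_j$. The Adams operations $\Psi^n$ ($n\ge1$) of a $\lambda$-ring are defined by $\frac{d}{dt}\log\lambda_t(x)=\sum_{n\ge0}(-1)^n\Psi^{n+1}(x)t^n$.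 Let $G$ be a finite group and $K$ a field. The Green algebra $\Gamma_K(G)$ is $\mathbb C\otimes_{\mathbb Z}R_K(G)$, where $R_K(G)$ is the ring generated additively by the isomorphism classes $[V]$ of finite-dimensional $KG$-modules with $[U\oplus V]=[U]+[V]$ and $[U][V]=[U\otimes V]$. The Grothendieck algebra $\overline\Gamma_K(G)$ is the quotient of $\Gamma_K(G)$ by the ideal spanned by all $[V]-[U]-[W]$ for short exact sequences $0\to U\to V\to W\to0$; write $\overline V$ for the image of $[V]$. Let $p=\operatorname{char}K$, let $G_{p'}$ be the set of elements of $G$ of order not divisible by $p$ (all of $G$ if $p=0$), let $e$ be the least common multiple of the orders of its elements, and let $\mathcal C$ be the $\mathbb C$-algebra of functions $f:G_{p'}\to\mathbb C$ that are constant on $G$-conjugacy classes, with the operations $\Psi^n(f)(g)=f(g^n)$, under which $\mathcal C$ is stable. **Proposition.** Let $G$ be a finite group and $K$ any field. Then $\overline\Gamma_K(G)$ carries a special $\lambda$-ring structure with $\lambda^n(\overline V)=\overline{\Lambda^nV}$ for all $n\ge 0$ and all finite-dimensional $KG$-modules $V$. Moreover, for every choice of primitive $e$-th roots of unity $\xi$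 in an algebraic closure $\hat K$ of $K$ and $\omega\in\mathbb C$: 1. there is an injective $\mathbb C$-algebra homomorphism $\mathrm{ch}:\overline\Gamma_K(G)\to\mathcal C$ sending $\overline V$ to the Brauer character $a\mapsto\omega^{k_1}+\dots+\omega^{k_r}$, where $\xi^{k_1},\dots,\xi^{k_r}$ are the eigenvalues, with multiplicity, of $a$ on $\hat K\otimes_K V$; 2. the Adams operations of the $\lambda$-ring $\overline\Gamma_K(G)$ satisfy $\mathrm{ch}(\Psi^n(x))=\Psi^n(\mathrm{ch}(x))$ for all $n\ge1$ and all $x$ (so the image of $\mathrm{ch}$ is stable under the $\Psi^n$); 3. this is the only special $\lambda$-ring structure on $\overline\Gamma_K(G)$ with property 2. -/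

import Mathlib

universe u v

noncomputable section

open CategoryTheory

/-! ### Universal polynomials -/

namespace LambdaRing

open MvPolynomial

/-- The coefficient of `t ^ n` in `∏ (1 + x_i y_j t)`, with `n` variables `x_i` and `n` variables
`y_j` (which is enough to determine the symmetric function in degree `n`). -/
def prodCoeff (n : ℕ) : MvPolynomial (Fin n ⊕ Fin n) ℤ :=
  (∏ i : Fin n, ∏ j : Fin n,
    (1 + Polynomial.C (X (Sum.inl i) * X (Sum.inr j) : MvPolynomial (Fin n ⊕ Fin n) ℤ) *
      Polynomial.X)).coeff n

/-- The coefficient of `t ^ n` in `∏_{i_1 < ... < i_m} (1 + x_{i_1} ... x_{i_m} t)`, with `n * m`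
variables `x_i` (which is enough to determine the symmetric function in degree `n * m`). -/
def compCoeff (n m : ℕ) : MvPolynomial (Fin (n * m)) ℤ :=
  (∏ S ∈ (Finset.univ : Finset (Fin (n * m))).powersetCard m,
    (1 + Polynomial.C (∏ i ∈ S, X i : MvPolynomial (Fin (n * m)) ℤ) * Polynomial.X)).coeff n

/-- The elementary symmetric polynomials `s_1, ..., s_n` of the `x_i` and `σ_1, ..., σ_n` of the
`y_j`. -/
def bothEsymm (n : ℕ) : Fin n ⊕ Fin n → MvPolynomial (Fin n ⊕ Fin n) ℤ :=
  Sum.elim (fun k => rename Sum.inl (esymm (Fin n) ℤ (k + 1)))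
    (fun k => rename Sum.inr (esymm (Fin n) ℤ (k + 1)))

theorem prod_one_add_eq (n : ℕ) {R : Type*} [CommRing R] (y : Fin n → R) (z : R) :
    ∏ j : Fin n, (1 + Polynomial.C (z * y j) * Polynomial.X) =
      1 + ∑ k : Fin n, Polynomial.C (z ^ (k.1 + 1) * aeval y (esymm (Fin n) ℤ (k + 1))) *
        Polynomial.X ^ (k.1 + 1) := by
  rw [Finset.prod_one_add, Finset.sum_powerset, Finset.card_univ, Fintype.card_fin,
    Finset.sum_range_succ']
  rw [add_comm, ← Fin.sum_univ_eq_sum_range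
    (fun k => ∑ t ∈ Finset.powersetCard (k + 1) Finset.univ,
      ∏ j ∈ t, (Polynomial.C (z * y j) * Polynomial.X)) n]
  congr 1
  · simp
  refine Finset.sum_congr rfl fun k _ => ?_
  simp only [esymm, map_sum, map_prod, aeval_X, Finset.mul_sum, Finset.sum_mul]
  refine Finset.sum_congr rfl fun t ht => ?_
  rw [Finset.prod_mul_distrib, Finset.prod_const, (Finset.mem_powersetCard.1 ht).2,
    ← map_prod, Finset.prod_mul_distrib, Finset.prod_const, (Finset.mem_powersetCard.1 ht).2]

/-- The coefficient of `t ^ n` in `∏ (1 + x_i y_j t)`, with the `k`-th elementary symmetric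
polynomial of the `y_j` replaced by an indeterminate `Y_k`. -/
def auxPoly (n : ℕ) : Polynomial (MvPolynomial (Fin n) (MvPolynomial (Fin n) ℤ)) :=
  ∏ i : Fin n, (1 + ∑ k : Fin n,
    Polynomial.C (X i ^ (k.1 + 1) * C (X k)) * Polynomial.X ^ (k.1 + 1))

theorem auxPoly_isSymmetric (n : ℕ) : ((auxPoly n).coeff n).IsSymmetric := by
  intro e
  refine (Polynomial.coeff_map (rename e : MvPolynomial (Fin n) (MvPolynomial (Fin n) ℤ)
    →ₐ[MvPolynomial (Fin n) ℤ] _).toRingHom n).symm.trans ?_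
  congr 1
  simp only [auxPoly, Polynomial.map_prod, Polynomial.map_add, Polynomial.map_one,
    Polynomial.map_sum, Polynomial.map_mul, Polynomial.map_C, Polynomial.map_pow,
    Polynomial.map_X, AlgHom.toRingHom_eq_coe, RingHom.coe_coe, map_mul, map_pow, rename_X,
    rename_C]
  exact Equiv.prod_comp e (fun i => (1 + ∑ k : Fin n,
      (Polynomial.C (X i) ^ (k.1 + 1) *
        Polynomial.C (C (X k) : MvPolynomial (Fin n) (MvPolynomial (Fin n) ℤ))) *
        Polynomial.X ^ (k.1 + 1)))

/-- The map sending `Y_k` to the `k`-th elementary symmetric polynomial of the `y_j`. -/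
def auxEval (n : ℕ) : MvPolynomial (Fin n) ℤ →+* MvPolynomial (Fin n ⊕ Fin n) ℤ :=
  eval₂Hom (Int.castRingHom _) (fun k : Fin n => rename Sum.inr (esymm (Fin n) ℤ (k + 1)))

theorem auxEval_X (n : ℕ) (k : Fin n) :
    auxEval n (X k) = rename Sum.inr (esymm (Fin n) ℤ (k + 1)) := by
  simp [auxEval]

theorem aeval_sumAlgEquiv_symm (n : ℕ) (r : MvPolynomial (Fin n) (MvPolynomial (Fin n) ℤ)) :
    aeval (bothEsymm n) ((sumAlgEquiv ℤ (Fin n) (Fin n)).symm r) =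
      eval₂Hom (auxEval n) (fun i => X (Sum.inl i))
        (aeval (fun i : Fin n => esymm (Fin n) (MvPolynomial (Fin n) ℤ) (i + 1)) r) := by
  have h : ((aeval (bothEsymm n) : MvPolynomial (Fin n ⊕ Fin n) ℤ →ₐ[ℤ] _).toRingHom.comp
      ((sumAlgEquiv ℤ (Fin n) (Fin n)).symm.toAlgHom.toRingHom)) =
      (eval₂Hom (auxEval n) (fun i => X (Sum.inl i))).comp
        (aeval (fun i : Fin n => esymm (Fin n) (MvPolynomial (Fin n) ℤ) (i + 1)) :
          MvPolynomial (Fin n) (MvPolynomial (Fin n) ℤ) →ₐ[MvPolynomial (Fin n) ℤ] _).toRingHom := by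
    refine MvPolynomial.ringHom_ext' (MvPolynomial.ringHom_ext' ?_ ?_) ?_
    · exact RingHom.ext_int _ _
    · intro k
      simp [sumAlgEquiv_symm_C_X, auxEval_X, bothEsymm]
    · intro k
      simp [sumAlgEquiv_symm_X, bothEsymm, esymm]
  exact RingHom.congr_fun h r

theorem exists_prodPoly (n : ℕ) :
    ∃ P : MvPolynomial (Fin n ⊕ Fin n) ℤ, aeval (bothEsymm n) P = prodCoeff n := by
  obtain ⟨q, hq⟩ := (esymmAlgEquiv (Fin n) (MvPolynomial (Fin n) ℤ)
    (Fintype.card_fin n)).surjective ⟨_, auxPoly_isSymmetric n⟩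
  have hq' : aeval (fun i : Fin n => esymm (Fin n) (MvPolynomial (Fin n) ℤ) (i + 1)) q =
      (auxPoly n).coeff n := by
    rw [← esymmAlgHom_apply]
    exact congrArg Subtype.val hq
  refine ⟨(sumAlgEquiv ℤ (Fin n) (Fin n)).symm q, ?_⟩
  rw [aeval_sumAlgEquiv_symm, hq', ← Polynomial.coeff_map]
  unfold prodCoeff auxPoly
  congr 1
  rw [Polynomial.map_prod]
  refine Finset.prod_congr rfl fun i _ => ?_
  rw [prod_one_add_eq n (fun j => X (Sum.inr j) : Fin n → MvPolynomial (Fin n ⊕ Fin n) ℤ)]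
  simp only [Polynomial.map_add, Polynomial.map_one, Polynomial.map_sum,
    Polynomial.map_mul, Polynomial.map_C, Polynomial.map_pow, Polynomial.map_X, map_mul, map_pow,
    coe_eval₂Hom, eval₂_X, eval₂_C, auxEval_X, rename_eq_aeval]
  rfl

theorem exists_compPoly (n m : ℕ) :
    ∃ P : MvPolynomial (Fin (n * m)) ℤ,
      aeval (fun k : Fin (n * m) => esymm (Fin (n * m)) ℤ (k + 1)) P = compCoeff n m := by
  have hs : (compCoeff n m).IsSymmetric := by
    intro e
    unfold compCoeff
    refine (Polynomial.coeff_map (rename e : MvPolynomial (Fin (n * m)) ℤ →ₐ[ℤ] _).toRingHom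
      n).symm.trans ?_
    congr 1
    rw [Polynomial.map_prod]
    refine Finset.prod_bij (fun S _ => S.map e.toEmbedding) ?_ ?_ ?_ ?_
    · intro S hS
      simpa [Finset.mem_powersetCard] using hS
    · intro S _ T _ h
      exact Finset.map_injective _ h
    · intro S hS
      refine ⟨S.map e.symm.toEmbedding, ?_, ?_⟩
      · simpa [Finset.mem_powersetCard] using hS
      · ext x
        simp
    · intro S _
      simp [Polynomial.map_prod]
  obtain ⟨q, hq⟩ :=
    (esymmAlgEquiv (Fin (n * m)) ℤ (Fintype.card_fin _)).surjective ⟨compCoeff n m, hs⟩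
  refine ⟨q, ?_⟩
  rw [← esymmAlgHom_apply]
  exact congrArg Subtype.val hq

/-- The universal polynomial `P_n(s_1, ..., s_n; σ_1, ..., σ_n)`: the polynomial expressing the
coefficient of `t ^ n` in `∏ (1 + x_i y_j t)` through the elementary symmetric polynomials (it is
unique since these are algebraically independent). -/
def prodPoly (n : ℕ) : MvPolynomial (Fin n ⊕ Fin n) ℤ := (exists_prodPoly n).choose

theorem aeval_prodPoly (n : ℕ) : aeval (bothEsymm n) (prodPoly n) = prodCoeff n :=
  (exists_prodPoly n).choose_spec

/-- The universal polynomial `P_{n,m}(s_1, ..., s_{nm})`: the polynomial expressing the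
coefficient of `t ^ n` in `∏_{i_1 < ... < i_m} (1 + x_{i_1} ... x_{i_m} t)` through the elementary
symmetric polynomials (it is unique since these are algebraically independent). -/
def compPoly (n m : ℕ) : MvPolynomial (Fin (n * m)) ℤ := (exists_compPoly n m).choose

theorem aeval_compPoly (n m : ℕ) :
    aeval (fun k : Fin (n * m) => esymm (Fin (n * m)) ℤ (k + 1)) (compPoly n m) =
      compCoeff n m :=
  (exists_compPoly n m).choose_spec

end LambdaRing

/-! ### Lambda-rings -/

/-- A `λ`-ring structure on the commutative ring `R`: operations `λ ^ n` with `λ ^ 0 = 1`,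
`λ ^ 1 = id` and `λ ^ n (x + y) = ∑ λ ^ r (x) λ ^ (n - r) (y)`. -/
@[ext]
structure LambdaRing (R : Type*) [CommRing R] where
  lam : ℕ → R → R
  lam_zero : ∀ x, lam 0 x = 1
  lam_one : ∀ x, lam 1 x = x
  lam_add : ∀ n x y, lam n (x + y) = ∑ r ∈ Finset.range (n + 1), lam r x * lam (n - r) y

/-- The underlying set `1 + A[[t]]⁺` of the ring `Λ(A)`. -/
def BigLambda (A : Type*) [CommRing A] : Type _ :=
  {f : PowerSeries A // PowerSeries.constantCoeff f = 1}

namespace BigLambda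

variable {A : Type*} [CommRing A]

/-- The coefficient of `t ^ n`. -/
def coeff (n : ℕ) (f : BigLambda A) : A := PowerSeries.coeff n f.1

/-- The element `1 + ∑_{n ≥ 1} a_n t ^ n`. -/
def ofCoeffs (a : ℕ → A) : BigLambda A :=
  ⟨PowerSeries.mk fun n => if n = 0 then 1 else a n, by simp⟩

/-- Addition in `Λ(A)` is multiplication of power series. -/
instance : Add (BigLambda A) :=
  ⟨fun f g => ⟨f.1 * g.1, by rw [map_mul, f.2, g.2, one_mul]⟩⟩

/-- Multiplication in `Λ(A)` is given by the polynomials `P_n`. -/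
instance : Mul (BigLambda A) :=
  ⟨fun f g => ofCoeffs fun n => MvPolynomial.aeval
    (Sum.elim (fun k : Fin n => f.coeff (k + 1)) (fun k : Fin n => g.coeff (k + 1)))
    (LambdaRing.prodPoly n)⟩

/-- The unit element of `Λ(A)` is `1 + t`. -/
instance : One (BigLambda A) := ⟨⟨1 + PowerSeries.X, by simp⟩⟩

/-- The operation `Λ ^ m` on `Λ(A)`, given by the polynomials `P_{n,m}`. -/
def lam (m : ℕ) (f : BigLambda A) : BigLambda A :=
  ofCoeffs fun n => MvPolynomial.aeval (fun k : Fin (n * m) => f.coeff (k + 1))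
    (LambdaRing.compPoly n m)

end BigLambda

namespace LambdaRing

variable {R : Type*} [CommRing R]

/-- The map `λ_t : R → Λ(R)`, `λ_t(x) = ∑ λ ^ n (x) t ^ n`. -/
def lamT (L : LambdaRing R) (x : R) : BigLambda R :=
  ⟨PowerSeries.mk fun n => L.lam n x, by
    simp [← PowerSeries.coeff_zero_eq_constantCoeff_apply, L.lam_zero]⟩

/-- A `λ`-ring is special if `λ_t : R → Λ(R)` is a ring homomorphism commuting with the
`λ`-operations. -/
structure IsSpecial (L : LambdaRing R) : Prop where
  map_one : L.lamT 1 = 1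
  map_add : ∀ x y, L.lamT (x + y) = L.lamT x + L.lamT y
  map_mul : ∀ x y, L.lamT (x * y) = L.lamT x * L.lamT y
  map_lam : ∀ m x, L.lamT (L.lam m x) = (L.lamT x).lam m

/-- The `n`-th Adams operation for `n ≥ 1`, given by
`d/dt log λ_t(x) = ∑_{n ≥ 0} (-1) ^ n Ψ ^ (n + 1) (x) t ^ n`. -/
def adams (L : LambdaRing R) (n : ℕ) (x : R) : R :=
  (-1) ^ (n - 1) * PowerSeries.coeff (n - 1)
    (PowerSeries.derivative R (L.lamT x).1 * PowerSeries.invOfUnit (L.lamT x).1 1)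

end LambdaRing

/-! ### Green algebras and Grothendieck algebras -/

section Green

variable (K : Type u) [Field K] (G : Type v) [Group G]

/-- Isomorphism classes of finite-dimensional `KG`-modules, a commutative monoid under tensor
products. -/
abbrev RepClass : Type _ := Skeleton (FDRep K G)

variable {K G}

/-- The linear map underlying a homomorphism of `KG`-modules. -/
def repHomToLinear {U V : FDRep K G} (f : U ⟶ V) : U →ₗ[K] V := f.hom.hom.hom

/-- The direct sum of two finite-dimensional `KG`-modules. -/
def repSum (U V : FDRep K G) : FDRep K G := FDRep.of (Representation.prod U.ρ V.ρ)

/-- The action of `G` on the `n`-th exterior power of a `KG`-module. -/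
def exteriorRep (n : ℕ) (V : FDRep K G) : Representation K G (⋀[K]^n (V : Type u)) where
  toFun g := exteriorPower.map n (V.ρ g)
  map_one' := by rw [map_one]; exact exteriorPower.map_id
  map_mul' g h := by rw [map_mul]; exact exteriorPower.map_comp (V.ρ h) (V.ρ g)

/-- The `n`-th exterior power of a finite-dimensional `KG`-module. -/
def repExterior (n : ℕ) (V : FDRep K G) : FDRep K G := FDRep.of (exteriorRep n V)

/-- `0 → U → V → W → 0` is a short exact sequence of `KG`-modules. -/
def IsShortExactSeq {U V W : FDRep K G} (i : U ⟶ V) (q : V ⟶ W) : Prop :=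
  Function.Injective (repHomToLinear i) ∧
    Function.Exact (repHomToLinear i) (repHomToLinear q) ∧
    Function.Surjective (repHomToLinear q)

variable (K G)

/-- The ideal of `ℤ[RepClass K G]` of the relations `[U ⊕ V] = [U] + [V]`. -/
def greenRelations : Ideal (MonoidAlgebra ℤ (RepClass K G)) :=
  Ideal.span {x | ∃ U V : FDRep K G,
    x = MonoidAlgebra.of ℤ _ (toSkeleton (repSum U V)) - MonoidAlgebra.of ℤ _ (toSkeleton U)
      - MonoidAlgebra.of ℤ _ (toSkeleton V)}

/-- The Green ring `R_K(G)`: the additive group generated by the isomorphism classes `[V]` of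
finite-dimensional `KG`-modules with `[U ⊕ V] = [U] + [V]` (by Krull-Schmidt it is free on the
classes of indecomposable modules), with `[U][V] = [U ⊗ V]`. -/
def GreenRing : Type _ := MonoidAlgebra ℤ (RepClass K G) ⧸ greenRelations K G

instance : CommRing (GreenRing K G) :=
  inferInstanceAs (CommRing (MonoidAlgebra ℤ (RepClass K G) ⧸ greenRelations K G))

/-- The Green algebra `Γ_K(G) = ℂ ⊗ R_K(G)`. -/
def GreenAlgebra : Type _ := TensorProduct ℤ ℂ (GreenRing K G)

instance : CommRing (GreenAlgebra K G) :=
  inferInstanceAs (CommRing (TensorProduct ℤ ℂ (GreenRing K G)))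

instance : Algebra ℂ (GreenAlgebra K G) :=
  inferInstanceAs (Algebra ℂ (TensorProduct ℤ ℂ (GreenRing K G)))

variable {K G}

/-- The class `[V]` in the Green ring. -/
def greenRingClass (V : FDRep K G) : GreenRing K G :=
  Ideal.Quotient.mk (greenRelations K G) (MonoidAlgebra.of ℤ _ (toSkeleton V))

/-- The class `1 ⊗ [V]` in the Green algebra. -/
def greenClass (V : FDRep K G) : GreenAlgebra K G :=
  TensorProduct.tmul ℤ 1 (greenRingClass V)

variable (K G)

/-- The ideal `I` of `Γ_K(G)` spanned by all `[V] - [U] - [W]` for short exact sequences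
`0 → U → V → W → 0` (the linear span is already an ideal, as tensoring is exact). -/
def exactRelations : Ideal (GreenAlgebra K G) :=
  Ideal.span {x | ∃ (U V W : FDRep K G) (i : U ⟶ V) (q : V ⟶ W), IsShortExactSeq i q ∧
    x = greenClass V - greenClass U - greenClass W}

/-- The Grothendieck algebra of `G` over `K`, the quotient of the Green algebra by `I`. -/
def GrothendieckAlgebra : Type _ := GreenAlgebra K G ⧸ exactRelations K G

instance : CommRing (GrothendieckAlgebra K G) :=
  inferInstanceAs (CommRing (GreenAlgebra K G ⧸ exactRelations K G))

instance : Algebra ℂ (GrothendieckAlgebra K G) :=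
  inferInstanceAs (Algebra ℂ (GreenAlgebra K G ⧸ exactRelations K G))

variable {K G}

/-- The class of a `KG`-module `V` in the Grothendieck algebra. -/
def grothendieckClass (V : FDRep K G) : GrothendieckAlgebra K G :=
  Ideal.Quotient.mk (exactRelations K G) (greenClass V)

end Green

/-! ### Brauer characters -/

section Brauer

variable (K : Type u) [Field K] (G : Type v) [Group G]

/-- The set `G_{p'}` of elements of order not divisible by `p = char K` (for `p = 0` and finite
`G` these are all elements, as `0 ∣ m` only for `m = 0`). -/
def regularElements : Set G := {g | ¬ ringChar K ∣ orderOf g}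

/-- The least common multiple of the orders of the elements of `G_{p'}`. -/
def regularExponent [Finite G] : ℕ := (Set.toFinite (regularElements K G)).toFinset.lcm orderOf

/-- The algebra of class functions `G_{p'} → ℂ`. -/
def RegularClassFunctions : Subalgebra ℂ (regularElements K G → ℂ) where
  carrier := {f | ∀ a b : regularElements K G, IsConj (a : G) (b : G) → f a = f b}
  mul_mem' hf hg a b h := by rw [Pi.mul_apply, Pi.mul_apply, hf a b h, hg a b h]
  add_mem' hf hg a b h := by rw [Pi.add_apply, Pi.add_apply, hf a b h, hg a b h]
  algebraMap_mem' _ _ _ _ := rfl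

variable {K G}

theorem pow_mem_regularElements {g : G} (hg : g ∈ regularElements K G) (n : ℕ) :
    g ^ n ∈ regularElements K G :=
  fun h => hg (h.trans (orderOf_pow_dvd n))

/-- The operation `Ψ ^ n (f) (g) = f (g ^ n)` on class functions. -/
def classPsi (n : ℕ) (f : RegularClassFunctions K G) : RegularClassFunctions K G :=
  ⟨fun a => f.1 ⟨(a : G) ^ n, pow_mem_regularElements a.2 n⟩, fun a b h => by
    refine f.2 _ _ ?_
    obtain ⟨c, hc⟩ := isConj_iff.1 h
    exact isConj_iff.2 ⟨c, by rw [← conj_pow, hc]⟩⟩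

open scoped Classical in
/-- The map `ξ ^ k ↦ ω ^ k` from the powers of `ξ` to those of `ω` (well defined when `ξ` and `ω`
are primitive roots of unity of the same order; `0` off the powers of `ξ`). -/
def liftRoot {F : Type*} [Field F] (ξ : F) (ω : ℂ) (x : F) : ℂ :=
  if h : ∃ k : ℕ, ξ ^ k = x then ω ^ h.choose else 0

/-- The value `ω ^ k_1 + ... + ω ^ k_r` at `a` of the Brauer character of `V`, where
`ξ ^ k_1, ..., ξ ^ k_r` are the eigenvalues, with multiplicity, of `a` on `K̂ ⊗ V`, for `K̂` the
algebraic closure of `K`. -/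
def brauerCharacter (ξ : AlgebraicClosure K) (ω : ℂ) (V : FDRep K G) (a : G) : ℂ :=
  ((((V.ρ a).baseChange (AlgebraicClosure K)).charpoly.roots).map (liftRoot ξ ω)).sum

end Brauer

end

/-!
Over a `ℂ`-algebra `A`, Newton's identities make a power series with constant coefficient `1` the
same thing as the sequence of its power sums (`NewtonSeries.ofPowerSums`,
`NewtonSeries.eq_of_powerSum_eq`), and the Adams operations of a `λ`-ring are the power sums of
`λ_t(x)`. Hence a `λ`-ring structure on `A` is determined by its Adams operations
(`LambdaRing.eq_of_adams_eq`), which gives uniqueness, and ring endomorphisms `Ψ_n` of `A` with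
`Ψ_1 = id` define one (`LambdaRing.ofAdams`). If moreover `Ψ_m Ψ_n = Ψ_{mn}` and `A` embeds in a
product of copies of `ℂ`, this structure is special (`LambdaRing.isSpecial_ofAdams`): the identities
to be checked can be tested after a homomorphism to `ℂ`, where a power series is, up to any given
degree, a product of factors `1 + x_i t`, and on such products the universal polynomials `P_n` and
`P_{n,m}` are evaluated by their definition.

The Brauer character is a homomorphism `brauerHom` on the Grothendieck algebra since characteristic
polynomials are multiplicative in short exact sequences and elements of order prime to the
characteristic are diagonalizable over the algebraic closure. The same diagonalization shows that
the Brauer characters of the exterior powers of `V` at `a` are the elementary symmetric functions of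
complex numbers whose power sums are the Brauer character of `V` at the powers of `a`
(`exists_brauerLift_pow_exteriorPower`). As power sums are integral polynomials in elementary
symmetric functions, the image of `brauerHom` is stable under the operations `Ψ ^ n` on class
functions (`classPsi_mem_range`). Once `brauerHom` is known to be injective, these operations can be
transported to the Grothendieck algebra, and the structure they define has
`λ ^ n [V] = [Λ^n V]`.

Injectivity amounts to the linear independence of the Brauer characters of the irreducible modules
(`linearIndependent_brauerCharacter`). Over the algebraic closure, Jacobson density shows that the
traces of pairwise non-isomorphic irreducible representations are linearly independent; in
characteristic `p` the trace of `g` is that of a `p`-regular power of `g`, so they remain independent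
on the regular elements. Some minor of their values is thus non-zero; it is the value at `ξ` of an
integral polynomial, whose value at `ω` is the corresponding minor for the Brauer characters, and an
integral polynomial vanishing at `ω` is divisible by the cyclotomic polynomial and hence vanishes at
`ξ` (`LinearIndependent.of_aeval_primitiveRoot`). Over `K` itself, Jacobson density provides elements
of the group algebra acting as the identity on one of the given irreducible modules and as zero on
the others. After extension of scalars these separate the composition factors of the different
modules, so that their Brauer characters are combinations of disjoint parts of a linearly independent
family.
-/

noncomputable section

/-! ### Power series and their power sums -/

namespace NewtonSeries

open PowerSeries Finset

section Ring

variable {R : Type*} [CommRing R]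

/-- The logarithmic derivative `∑ (-1) ^ k s (k + 1) t ^ k` of a power series with power sums
`s 1, s 2, ...`; the value `s 0` plays no role. -/
def logDer (s : ℕ → R) : PowerSeries R := PowerSeries.mk fun k => (-1) ^ k * s (k + 1)

/-- The `n`-th power sum (`n ≥ 1`) of the power series `f` with constant coefficient `1`, that is
`∑ x_i ^ n` if `f = ∏ (1 + x_i t)`. -/
def powerSum (f : PowerSeries R) (n : ℕ) : R :=
  (-1) ^ (n - 1) * PowerSeries.coeff (n - 1)
    (PowerSeries.derivative R f * PowerSeries.invOfUnit f 1)

theorem logDer_powerSum (f : PowerSeries R) :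
    logDer (powerSum f) = PowerSeries.derivative R f * PowerSeries.invOfUnit f 1 := by
  ext k
  simp only [logDer, powerSum, coeff_mk, Nat.add_sub_cancel, ← mul_assoc, ← mul_pow]
  simp

theorem derivative_eq_mul_logDer_powerSum {f : PowerSeries R} (hf : constantCoeff f = 1) :
    PowerSeries.derivative R f = f * logDer (powerSum f) := by
  rw [logDer_powerSum, mul_left_comm, mul_invOfUnit f 1 (by simpa using hf), mul_one]

theorem powerSum_eq_of_derivative_eq {f : PowerSeries R} (hf : constantCoeff f = 1) {s : ℕ → R}
    (h : PowerSeries.derivative R f = f * logDer s) {n : ℕ} (hn : 1 ≤ n) :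
    powerSum f n = s n := by
  obtain ⟨k, rfl⟩ := Nat.exists_eq_add_of_le' hn
  rw [powerSum, h, mul_right_comm, mul_invOfUnit f 1 (by simpa using hf), one_mul, logDer, coeff_mk,
    Nat.add_sub_cancel, ← mul_assoc, ← mul_pow]
  simp

theorem logDer_congr_coeff {s s' : ℕ → R} {n : ℕ} (h : ∀ k, 1 ≤ k → k ≤ n → s k = s' k) :
    ∀ k < n, coeff k (logDer s) = coeff k (logDer s') := fun k hk => by
  rw [logDer, logDer, coeff_mk, coeff_mk, h _ (by lia) (by lia)]

/-- The `n`-th power sum depends only on the coefficients up to degree `n`. -/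
theorem powerSum_congr {f g : PowerSeries R} (hf : constantCoeff f = 1)
    (hg : constantCoeff g = 1) {n : ℕ} (h : ∀ k ≤ n, coeff k f = coeff k g) :
    ∀ k, 1 ≤ k → k ≤ n → powerSum f k = powerSum g k := by
  intro k hk
  induction k using Nat.strong_induction_on with
  | _ k ih =>
    intro hkn
    obtain ⟨m, rfl⟩ := Nat.exists_eq_add_of_le' hk
    have key : ∀ {f : PowerSeries R}, constantCoeff f = 1 →
        (-1) ^ m * powerSum f (m + 1) = coeff (m + 1) f * (m + 1) -
          ∑ x ∈ range m, coeff (m - x) f * ((-1) ^ x * powerSum f (x + 1)) := by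
      intro f hf
      rw [← coeff_derivative, derivative_eq_mul_logDer_powerSum hf, mul_comm f, coeff_mul,
        Nat.sum_antidiagonal_eq_sum_range_succ_mk, sum_range_succ]
      simp [logDer, hf, mul_comm]
    have e : (-1 : R) ^ m * powerSum f (m + 1) = (-1) ^ m * powerSum g (m + 1) := by
      rw [key hf, key hg, h _ hkn]
      congr 1
      refine sum_congr rfl fun x hx => ?_
      have := mem_range.1 hx
      rw [h _ (by lia), ih (x + 1) (by lia) (by lia) (by lia)]
    have := congrArg (fun y => (-1 : R) ^ m * y) e
    simpa [← mul_assoc, ← mul_pow] using this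

theorem map_powerSum {S : Type*} [CommRing S] (φ : R →+* S) {f : PowerSeries R}
    (hf : constantCoeff f = 1) {n : ℕ} (hn : 1 ≤ n) :
    φ (powerSum f n) = powerSum (PowerSeries.map φ f) n := by
  have hf' : constantCoeff (PowerSeries.map φ f) = 1 := by
    rw [← coeff_zero_eq_constantCoeff_apply, coeff_map, coeff_zero_eq_constantCoeff_apply, hf,
      map_one]
  refine (powerSum_eq_of_derivative_eq hf' (s := fun n => φ (powerSum f n)) ?_ hn).symm
  have h := congrArg (PowerSeries.map φ) (derivative_eq_mul_logDer_powerSum hf)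
  rw [map_mul] at h
  convert h using 1
  · ext k
    simp [coeff_derivative]
  · congr 1
    ext k
    simp [logDer]

end Ring

section Algebra

variable {R : Type*} [CommRing R] [Algebra ℂ R]

/-- The coefficients of the power series with power sums `s 1, s 2, ...`, given by Newton's
identities. -/
def newtonCoeff (s : ℕ → R) : ℕ → R
  | 0 => 1
  | n + 1 => ((n : ℂ) + 1)⁻¹ •
      ∑ k : Fin (n + 1), newtonCoeff s k * ((-1) ^ (n - k.1) * s (n - k.1 + 1))

/-- The power series `exp (∑ (-1) ^ (n - 1) s_n t ^ n / n)` with constant coefficient `1` and power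
sums `s 1, s 2, ...`. -/
def ofPowerSums (s : ℕ → R) : PowerSeries R := PowerSeries.mk (newtonCoeff s)

theorem constantCoeff_ofPowerSums (s : ℕ → R) : constantCoeff (ofPowerSums s) = 1 := by
  rw [← coeff_zero_eq_constantCoeff_apply, ofPowerSums, coeff_mk, newtonCoeff]

theorem mul_natCast_succ_cancel {a b : R} {n : ℕ} (h : a * (n + 1) = b * (n + 1)) : a = b := by
  have hn : (n : ℂ) + 1 ≠ 0 := Nat.cast_add_one_ne_zero n
  have e : ∀ c : R, c = ((n : ℂ) + 1)⁻¹ • (c * (n + 1)) := fun c => by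
    have : c * ((n : R) + 1) = ((n : ℂ) + 1) • c := by
      rw [Algebra.smul_def, map_add, map_natCast, map_one, mul_comm]
    rw [this, smul_smul, inv_mul_cancel₀ hn, one_smul]
  rw [e a, e b, h]

theorem derivative_ofPowerSums (s : ℕ → R) :
    PowerSeries.derivative R (ofPowerSums s) = ofPowerSums s * logDer s := by
  ext n
  have hn : (n : ℂ) + 1 ≠ 0 := Nat.cast_add_one_ne_zero n
  have e : ((n : R) + 1) = algebraMap ℂ R ((n : ℂ) + 1) := by simp
  rw [coeff_derivative, ofPowerSums, coeff_mk, newtonCoeff, mul_comm, e, ← Algebra.smul_def,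
    smul_smul, mul_inv_cancel₀ hn, one_smul, coeff_mul,
    Nat.sum_antidiagonal_eq_sum_range_succ_mk, ← Fin.sum_univ_eq_sum_range
    (fun k => coeff k (PowerSeries.mk (newtonCoeff s)) * coeff (n - k) (logDer s))]
  simp [logDer]

theorem powerSum_ofPowerSums (s : ℕ → R) {n : ℕ} (hn : 1 ≤ n) :
    powerSum (ofPowerSums s) n = s n :=
  powerSum_eq_of_derivative_eq (constantCoeff_ofPowerSums s) (derivative_ofPowerSums s) hn

/-- The coefficients up to degree `n` depend only on the first `n` power sums. -/
theorem coeff_congr {f g : PowerSeries R} (hf : constantCoeff f = 1) (hg : constantCoeff g = 1)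
    {n : ℕ} (h : ∀ k, 1 ≤ k → k ≤ n → powerSum f k = powerSum g k) :
    ∀ k ≤ n, coeff k f = coeff k g := by
  intro k
  induction k using Nat.strong_induction_on with
  | _ k ih =>
    intro hkn
    obtain _ | m := k
    · simp [hf, hg]
    · refine mul_natCast_succ_cancel (n := m) ?_
      rw [← coeff_derivative, ← coeff_derivative, derivative_eq_mul_logDer_powerSum hf,
        derivative_eq_mul_logDer_powerSum hg, coeff_mul, coeff_mul]
      refine sum_congr rfl fun x hx => ?_
      have := mem_antidiagonal.1 hx
      rw [ih x.1 (by lia) (by lia), logDer_congr_coeff h x.2 (by lia)]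

theorem eq_of_powerSum_eq {f g : PowerSeries R} (hf : constantCoeff f = 1)
    (hg : constantCoeff g = 1) (h : ∀ k, 1 ≤ k → powerSum f k = powerSum g k) : f = g := by
  ext n
  exact coeff_congr hf hg (fun k hk _ => h k hk) n le_rfl

theorem coeff_ofPowerSums_congr {s s' : ℕ → R} {n : ℕ} (h : ∀ k, 1 ≤ k → k ≤ n → s k = s' k) :
    coeff n (ofPowerSums s) = coeff n (ofPowerSums s') :=
  coeff_congr (constantCoeff_ofPowerSums s) (constantCoeff_ofPowerSums s')
    (fun k hk hkn => by rw [powerSum_ofPowerSums s hk, powerSum_ofPowerSums s' hk, h k hk hkn])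
    n le_rfl

theorem ofPowerSums_eq {f : PowerSeries R} (hf : constantCoeff f = 1) {s : ℕ → R}
    (h : PowerSeries.derivative R f = f * logDer s) : ofPowerSums s = f :=
  eq_of_powerSum_eq (constantCoeff_ofPowerSums s) hf fun k hk => by
    rw [powerSum_ofPowerSums s hk, powerSum_eq_of_derivative_eq hf h hk]

theorem ofPowerSums_add (s s' : ℕ → R) :
    ofPowerSums (s + s') = ofPowerSums s * ofPowerSums s' := by
  refine ofPowerSums_eq (by simp [constantCoeff_ofPowerSums]) ?_
  have : logDer (s + s') = logDer s + logDer s' := by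
    ext k
    simp [logDer, mul_add]
  rw [Derivation.leibniz, derivative_ofPowerSums, derivative_ofPowerSums, this, smul_eq_mul,
    smul_eq_mul]
  ring

theorem ofPowerSums_zero : ofPowerSums (0 : ℕ → R) = 1 :=
  ofPowerSums_eq (by simp) (by
    have : logDer (0 : ℕ → R) = 0 := by ext; simp [logDer]
    rw [this, mul_zero, derivative_one])

/-- A single variable: the series with power sums `x ^ n` is `1 + x t`. -/
theorem ofPowerSums_pow (x : R) :
    ofPowerSums (fun k => x ^ k) = 1 + PowerSeries.C x * PowerSeries.X := by
  refine ofPowerSums_eq (by simp) ?_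
  ext n
  rw [add_mul, one_mul, mul_assoc, map_add (coeff n), coeff_C_mul]
  obtain _ | n := n
  · simp [logDer]
  · rw [coeff_succ_X_mul]
    simp [logDer]
    ring

theorem ofPowerSums_sum {ι : Type*} (S : Finset ι) (x : ι → R) :
    ofPowerSums (fun k => ∑ i ∈ S, x i ^ k) =
      ∏ i ∈ S, (1 + PowerSeries.C (x i) * PowerSeries.X) := by
  classical
  induction S using Finset.induction_on with
  | empty =>
    simp only [sum_empty, prod_empty]
    exact ofPowerSums_zero
  | insert a S ha ih =>
    rw [prod_insert ha, ← ih, ← ofPowerSums_pow, ← ofPowerSums_add]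
    congr 1
    funext k
    simp [sum_insert ha]

theorem map_ofPowerSums {S : Type*} [CommRing S] [Algebra ℂ S] (φ : R →+* S) (s : ℕ → R) :
    PowerSeries.map φ (ofPowerSums s) = ofPowerSums (fun k => φ (s k)) := by
  have h : constantCoeff (PowerSeries.map φ (ofPowerSums s)) = 1 := by
    rw [← coeff_zero_eq_constantCoeff_apply, coeff_map, coeff_zero_eq_constantCoeff_apply,
      constantCoeff_ofPowerSums, map_one]
  refine eq_of_powerSum_eq h (constantCoeff_ofPowerSums _) fun k hk => ?_
  rw [← map_powerSum φ (constantCoeff_ofPowerSums s) hk, powerSum_ofPowerSums _ hk,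
    powerSum_ofPowerSums _ hk]

theorem coeff_ofPowerSums_map {S : Type*} [CommRing S] [Algebra ℂ S] (φ : R →+* S) (s : ℕ → R)
    (n : ℕ) : φ (coeff n (ofPowerSums s)) = coeff n (ofPowerSums (fun k => φ (s k))) := by
  rw [← map_ofPowerSums, coeff_map]

theorem coeff_ofPowerSums_sum {ι : Type*} (S : Finset ι) (x : ι → R) (n : ℕ) :
    coeff n (ofPowerSums (fun k => ∑ i ∈ S, x i ^ k)) =
      (∏ i ∈ S, (1 + Polynomial.C (x i) * Polynomial.X)).coeff n := by
  rw [ofPowerSums_sum, ← Polynomial.coeff_coe]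
  congr 1
  rw [← Polynomial.coeToPowerSeries.ringHom_apply, map_prod]
  simp

end Algebra

/-! ### Splitting over the complex numbers -/

theorem _root_.Polynomial.exists_eq_prod_one_add {k : Type*} [Field k] [IsAlgClosed k] (n : ℕ) :
    ∀ q : Polynomial k, q.natDegree ≤ n → q.coeff 0 = 1 →
      ∃ x : Fin n → k, q = ∏ i, (1 + Polynomial.C (x i) * Polynomial.X) := by
  induction n with
  | zero =>
    intro q hq h0
    refine ⟨Fin.elim0, ?_⟩
    rw [Polynomial.eq_C_of_natDegree_le_zero hq, h0]
    simp
  | succ n ih =>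
    intro q hq h0
    by_cases hd : q.natDegree = 0
    · refine ⟨0, ?_⟩
      rw [Polynomial.eq_C_of_natDegree_eq_zero hd, h0]
      simp
    · obtain ⟨r, hr⟩ := IsAlgClosed.exists_root q (by
        intro h
        exact hd (Polynomial.natDegree_eq_of_degree_eq_some h))
      obtain ⟨g, rfl⟩ := Polynomial.dvd_iff_isRoot.2 hr
      have hg : g ≠ 0 := by
        rintro rfl
        simp at hd
      have h1 : -r * g.coeff 0 = 1 := by simpa [Polynomial.mul_coeff_zero] using h0
      have hr0 : r ≠ 0 := by
        rintro rfl
        simp at h1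
      have hdeg : g.natDegree ≤ n := by
        rw [Polynomial.natDegree_mul (Polynomial.X_sub_C_ne_zero r) hg,
          Polynomial.natDegree_X_sub_C] at hq
        lia
      obtain ⟨x, hx⟩ := ih (Polynomial.C (-r) * g)
        ((Polynomial.natDegree_C_mul_le _ _).trans hdeg) (by simpa using h1)
      refine ⟨Fin.cons (-r⁻¹) x, ?_⟩
      rw [Fin.prod_univ_succ]
      simp only [Fin.cons_zero, Fin.cons_succ]
      rw [← hx, ← mul_assoc]
      congr 1
      have hC : (Polynomial.C r⁻¹ * Polynomial.C r : Polynomial k) = 1 := by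
        rw [← Polynomial.C_mul, inv_mul_cancel₀ hr0, Polynomial.C_1]
      simp only [Polynomial.C_neg]
      linear_combination -Polynomial.X * hC

/-- Up to any given degree, a complex power series with constant coefficient `1` is a product of
factors `1 + x_i t`. -/
theorem exists_coeff_eq_prod {f : PowerSeries ℂ} (hf : constantCoeff f = 1) (n : ℕ) :
    ∃ x : Fin n → ℂ, ∀ k ≤ n,
      coeff k f = (∏ i, (1 + Polynomial.C (x i) * Polynomial.X)).coeff k := by
  obtain ⟨x, hx⟩ := Polynomial.exists_eq_prod_one_add n (trunc (n + 1) f)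
    (Nat.lt_succ_iff.1 (natDegree_trunc_lt f n)) (by simp [coeff_trunc, hf])
  refine ⟨x, fun k hk => ?_⟩
  rw [← hx, coeff_trunc, if_pos (by lia)]

end NewtonSeries

/-! ### Adams operations and special `λ`-rings -/

namespace NewtonSeries

open PowerSeries Finset

theorem coeff_prod_one_add_C_mul_X {ι R : Type*} [CommRing R] (s : Finset ι) (y : ι → R) (m : ℕ) :
    (∏ i ∈ s, (1 + Polynomial.C (y i) * Polynomial.X)).coeff m =
      ∑ S ∈ s.powersetCard m, ∏ i ∈ S, y i := by
  classical
  rw [Finset.prod_one_add, Polynomial.finsetSum_coeff, powersetCard_eq_filter, sum_filter]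
  refine sum_congr rfl fun S _ => ?_
  rw [prod_mul_distrib, prod_const, ← map_prod, Polynomial.coeff_C_mul_X_pow]
  simp only [eq_comm]

theorem coeff_prod_one_add {n : ℕ} (x : Fin n → ℂ) (k : Fin n) :
    (∏ i, (1 + Polynomial.C (x i) * Polynomial.X)).coeff (k + 1) =
      MvPolynomial.aeval x (MvPolynomial.esymm (Fin n) ℤ (k + 1)) := by
  have h := LambdaRing.prod_one_add_eq n x 1
  simp only [one_mul, one_pow] at h
  rw [h, Polynomial.coeff_add, Polynomial.finsetSum_coeff, Finset.sum_eq_single k]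
  · rw [Polynomial.coeff_C_mul_X_pow, if_pos rfl, Polynomial.coeff_one, if_neg (by lia), zero_add]
  · intro b _ hb
    rw [Polynomial.coeff_C_mul_X_pow, if_neg]
    intro h
    exact hb (Fin.ext (by lia))
  · simp

/-- Multiplication in `Λ(ℂ)` multiplies power sums: truncating at degree `n`, both factors become
products of `n` linear factors, where the polynomial `P_n` is evaluated by its definition. -/
theorem aeval_prodPoly_eq {f g : PowerSeries ℂ} (hf : constantCoeff f = 1)
    (hg : constantCoeff g = 1) (n : ℕ) :
    MvPolynomial.aeval (Sum.elim (fun k : Fin n => coeff (k + 1) f)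
      (fun k : Fin n => coeff (k + 1) g)) (LambdaRing.prodPoly n) =
      coeff n (ofPowerSums fun k => powerSum f k * powerSum g k) := by
  obtain ⟨x, hx⟩ := exists_coeff_eq_prod hf n
  obtain ⟨y, hy⟩ := exists_coeff_eq_prod hg n
  have sums : ∀ {f : PowerSeries ℂ} (hf : constantCoeff f = 1) {x : Fin n → ℂ}
      (hx : ∀ k ≤ n, coeff k f = (∏ i, (1 + Polynomial.C (x i) * Polynomial.X)).coeff k),
      ∀ k, 1 ≤ k → k ≤ n → powerSum f k = ∑ i, x i ^ k := by
    intro f hf x hx k hk hkn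
    rw [← powerSum_ofPowerSums (fun k => ∑ i, x i ^ k) hk]
    refine powerSum_congr hf (constantCoeff_ofPowerSums _) (fun j hj => ?_) k hk hkn
    rw [hx j hj, coeff_ofPowerSums_sum]
  have e : Sum.elim (fun k : Fin n => coeff (k + 1) f) (fun k : Fin n => coeff (k + 1) g) =
      fun i => MvPolynomial.aeval (Sum.elim x y) (LambdaRing.bothEsymm n i) := by
    funext i
    rcases i with k | k
    · simp only [Sum.elim_inl, LambdaRing.bothEsymm, MvPolynomial.aeval_rename, Sum.elim_comp_inl]
      rw [hx _ (by lia), coeff_prod_one_add]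
    · simp only [Sum.elim_inr, LambdaRing.bothEsymm, MvPolynomial.aeval_rename, Sum.elim_comp_inr]
      rw [hy _ (by lia), coeff_prod_one_add]
  have e2 : MvPolynomial.aeval (Sum.elim (fun k : Fin n => coeff (k + 1) f)
      (fun k : Fin n => coeff (k + 1) g)) (LambdaRing.prodPoly n) =
      MvPolynomial.aeval (Sum.elim x y) (LambdaRing.prodCoeff n) := by
    rw [e, ← LambdaRing.aeval_prodPoly, ← MvPolynomial.comp_aeval_apply]
  rw [e2, coeff_ofPowerSums_congr (s' := fun k => ∑ p ∈ (univ ×ˢ univ : Finset (Fin n × Fin n)),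
    (x p.1 * y p.2) ^ k), coeff_ofPowerSums_sum, LambdaRing.prodCoeff, prod_product]
  · have := (Polynomial.coeff_map (MvPolynomial.aeval (R := ℤ) (Sum.elim x y)).toRingHom n
      (p := ∏ i : Fin n, ∏ j : Fin n, (1 + Polynomial.C (MvPolynomial.X (Sum.inl i) *
        MvPolynomial.X (Sum.inr j) : MvPolynomial (Fin n ⊕ Fin n) ℤ) * Polynomial.X)))
    refine this.symm.trans ?_
    simp [Polynomial.map_prod]
  · intro k hk hkn
    rw [sums hf hx k hk hkn, sums hg hy k hk hkn, sum_mul_sum, sum_product]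
    simp [mul_pow]

/-- The operation `Λ ^ m` on `Λ(ℂ)` in terms of power sums: the `k`-th power sum of the products
`x_{i_1} ⋯ x_{i_m}` is the `m`-th elementary symmetric function of the `x_i ^ k`. -/
theorem aeval_compPoly_eq {f : PowerSeries ℂ} (hf : constantCoeff f = 1) (n m : ℕ) :
    MvPolynomial.aeval (fun k : Fin (n * m) => coeff (k + 1) f) (LambdaRing.compPoly n m) =
      coeff n (ofPowerSums fun k => coeff m (ofPowerSums fun j => powerSum f (k * j))) := by
  obtain ⟨x, hx⟩ := exists_coeff_eq_prod hf (n * m)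
  have sums : ∀ k, 1 ≤ k → k ≤ n * m → powerSum f k = ∑ i, x i ^ k := by
    intro k hk hkn
    rw [← powerSum_ofPowerSums (fun k => ∑ i, x i ^ k) hk]
    refine powerSum_congr hf (constantCoeff_ofPowerSums _) (fun j hj => ?_) k hk hkn
    rw [hx j hj, coeff_ofPowerSums_sum]
  have e : (fun k : Fin (n * m) => coeff (k + 1) f) =
      fun k : Fin (n * m) => MvPolynomial.aeval x (MvPolynomial.esymm (Fin (n * m)) ℤ (k + 1)) := by
    funext k
    rw [hx _ (by lia), coeff_prod_one_add]
  have e2 : MvPolynomial.aeval (fun k : Fin (n * m) => coeff (k + 1) f)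
      (LambdaRing.compPoly n m) = MvPolynomial.aeval x (LambdaRing.compCoeff n m) := by
    rw [e, ← LambdaRing.aeval_compPoly, ← MvPolynomial.comp_aeval_apply]
  rw [e2, coeff_ofPowerSums_congr (s' := fun k => ∑ S ∈ (univ : Finset (Fin (n * m))).powersetCard m,
    (∏ i ∈ S, x i) ^ k), coeff_ofPowerSums_sum, LambdaRing.compCoeff]
  · have := (Polynomial.coeff_map (MvPolynomial.aeval (R := ℤ) x).toRingHom n
      (p := ∏ S ∈ (univ : Finset (Fin (n * m))).powersetCard m, (1 + Polynomial.C (∏ i ∈ S,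
        MvPolynomial.X i : MvPolynomial (Fin (n * m)) ℤ) * Polynomial.X)))
    refine this.symm.trans ?_
    simp [Polynomial.map_prod]
  · intro k hk hkn
    rw [coeff_ofPowerSums_congr (s' := fun j => ∑ i, (x i ^ k) ^ j), coeff_ofPowerSums_sum,
      coeff_prod_one_add_C_mul_X]
    · exact sum_congr rfl fun S _ => prod_pow S k x
    · intro j hj hjm
      rw [sums _ (Nat.mul_pos hk hj) (Nat.mul_le_mul hkn hjm)]
      simp [pow_mul]

end NewtonSeries

theorem BigLambda.coeff_ofCoeffs {A : Type*} [CommRing A] (a : ℕ → A) {n : ℕ} (hn : n ≠ 0) :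
    PowerSeries.coeff n (BigLambda.ofCoeffs a).1 = a n := by
  simp [BigLambda.ofCoeffs, hn]

theorem BigLambda.coeff_zero_eq_one {A : Type*} [CommRing A] (f : BigLambda A) :
    PowerSeries.coeff 0 f.1 = 1 := by
  rw [PowerSeries.coeff_zero_eq_constantCoeff_apply]
  exact f.2

namespace LambdaRing

open PowerSeries NewtonSeries

variable {A : Type*} [CommRing A]

theorem adams_eq_powerSum (L : LambdaRing A) (n : ℕ) (x : A) :
    L.adams n x = powerSum (L.lamT x).1 n := rfl

variable [Algebra ℂ A]

/-- The `λ`-ring structure on a `ℂ`-algebra with given Adams operations `Ψ 1, Ψ 2, ...`; the value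
`Ψ 0` plays no role. -/
def ofAdams (Ψ : ℕ → A →+* A) (h1 : ∀ x, Ψ 1 x = x) : LambdaRing A where
  lam n x := coeff n (ofPowerSums fun k => Ψ k x)
  lam_zero x := by
    rw [coeff_zero_eq_constantCoeff_apply, constantCoeff_ofPowerSums]
  lam_one x := by
    simp [ofPowerSums, newtonCoeff, h1]
  lam_add n x y := by
    have : (fun k => Ψ k (x + y)) = (fun k => Ψ k x) + fun k => Ψ k y := by
      funext k
      exact map_add _ _ _
    rw [this, ofPowerSums_add, coeff_mul, Finset.Nat.sum_antidiagonal_eq_sum_range_succ_mk]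

theorem lamT_ofAdams (Ψ : ℕ → A →+* A) (h1 : ∀ x, Ψ 1 x = x) (x : A) :
    ((ofAdams Ψ h1).lamT x).1 = ofPowerSums fun k => Ψ k x := by
  ext n
  simp [lamT, ofAdams]

theorem adams_ofAdams (Ψ : ℕ → A →+* A) (h1 : ∀ x, Ψ 1 x = x) {n : ℕ} (hn : 1 ≤ n) (x : A) :
    (ofAdams Ψ h1).adams n x = Ψ n x := by
  rw [adams_eq_powerSum, lamT_ofAdams, powerSum_ofPowerSums _ hn]

/-- Over `ℂ`, a `λ`-ring structure is determined by its Adams operations. -/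
theorem eq_of_adams_eq {L L' : LambdaRing A} (h : ∀ n, 1 ≤ n → ∀ x, L.adams n x = L'.adams n x) :
    L = L' := by
  have : ∀ x, (L.lamT x).1 = (L'.lamT x).1 := fun x =>
    eq_of_powerSum_eq (L.lamT x).2 (L'.lamT x).2 fun k hk => h k hk x
  ext n x
  have := congrArg (coeff n) (this x)
  simpa [lamT] using this

theorem map_aeval_int {σ R S : Type*} [CommRing R] [CommRing S] (φ : R →+* S) (v : σ → R)
    (P : MvPolynomial σ ℤ) :
    φ (MvPolynomial.aeval v P) = MvPolynomial.aeval (fun i => φ (v i)) P := by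
  have := MvPolynomial.comp_aeval_apply (R := ℤ) (f := v) φ.toIntAlgHom P
  exact this

/-- If `A` embeds in a product of copies of `ℂ`, then ring endomorphisms with `Ψ_m Ψ_n = Ψ_{mn}`
and `Ψ_1 = id` are the Adams operations of a special `λ`-ring structure: the identities to be
checked hold once they hold after every homomorphism to `ℂ`. -/
theorem isSpecial_ofAdams (hA : ∀ x : A, (∀ φ : A →ₐ[ℂ] ℂ, φ x = 0) → x = 0)
    (Ψ : ℕ → A →+* A) (h1 : ∀ x, Ψ 1 x = x)
    (hmul : ∀ m n, 1 ≤ m → 1 ≤ n → ∀ x, Ψ m (Ψ n x) = Ψ (m * n) x) :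
    (ofAdams Ψ h1).IsSpecial := by
  have hA' : ∀ x y : A, (∀ φ : A →ₐ[ℂ] ℂ, φ x = φ y) → x = y := fun x y h =>
    sub_eq_zero.1 (hA _ fun φ => by rw [map_sub, h φ, sub_self])
  refine ⟨?_, ?_, ?_, ?_⟩
  · refine Subtype.ext ?_
    rw [lamT_ofAdams]
    have h := ofPowerSums_pow (1 : A)
    simp only [one_pow, map_one, one_mul] at h
    simp only [map_one]
    exact h
  · intro x y
    refine Subtype.ext ?_
    change _ = ((ofAdams Ψ h1).lamT x).1 * ((ofAdams Ψ h1).lamT y).1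
    rw [lamT_ofAdams, lamT_ofAdams, lamT_ofAdams, ← ofPowerSums_add]
    congr 1
    funext k
    exact map_add _ _ _
  · intro x y
    refine Subtype.ext ?_
    ext n
    refine hA' _ _ fun φ => ?_
    obtain rfl | hn := eq_or_ne n 0
    · rw [BigLambda.coeff_zero_eq_one, BigLambda.coeff_zero_eq_one]
    rw [lamT_ofAdams]
    refine Eq.trans ?_ (congrArg φ (BigLambda.coeff_ofCoeffs _ hn)).symm
    refine (coeff_ofPowerSums_map φ.toRingHom _ n).trans (Eq.trans ?_
      (map_aeval_int φ.toRingHom _ _).symm)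
    set f := ofPowerSums fun k => φ (Ψ k x) with hf
    set g := ofPowerSums fun k => φ (Ψ k y) with hg
    have e : (fun i => φ.toRingHom ((Sum.elim
        (fun k : Fin n => ((ofAdams Ψ h1).lamT x).coeff (k + 1))
        (fun k : Fin n => ((ofAdams Ψ h1).lamT y).coeff (k + 1))) i)) =
        Sum.elim (fun k : Fin n => coeff (k + 1) f) (fun k : Fin n => coeff (k + 1) g) := by
      funext i
      rcases i with k | k
      · simp only [Sum.elim_inl, BigLambda.coeff, lamT_ofAdams]
        exact coeff_ofPowerSums_map φ.toRingHom _ _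
      · simp only [Sum.elim_inr, BigLambda.coeff, lamT_ofAdams]
        exact coeff_ofPowerSums_map φ.toRingHom _ _
    rw [e, aeval_prodPoly_eq (constantCoeff_ofPowerSums _) (constantCoeff_ofPowerSums _)]
    refine coeff_ofPowerSums_congr fun k hk _ => ?_
    rw [powerSum_ofPowerSums _ hk, powerSum_ofPowerSums _ hk, map_mul]
    exact map_mul φ _ _
  · intro m x
    refine Subtype.ext ?_
    ext n
    refine hA' _ _ fun φ => ?_
    obtain rfl | hn := eq_or_ne n 0
    · rw [BigLambda.coeff_zero_eq_one, BigLambda.coeff_zero_eq_one]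
    rw [lamT_ofAdams]
    refine Eq.trans ?_ (congrArg φ (BigLambda.coeff_ofCoeffs _ hn)).symm
    refine (coeff_ofPowerSums_map φ.toRingHom _ n).trans (Eq.trans ?_
      (map_aeval_int φ.toRingHom _ _).symm)
    set f := ofPowerSums fun k => φ (Ψ k x) with hf
    have e : (fun k : Fin (n * m) => φ.toRingHom (((ofAdams Ψ h1).lamT x).coeff (k + 1))) =
        fun k : Fin (n * m) => coeff (k + 1) f := by
      funext k
      simp only [BigLambda.coeff, lamT_ofAdams]
      exact coeff_ofPowerSums_map φ.toRingHom _ _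
    rw [e, aeval_compPoly_eq (constantCoeff_ofPowerSums _)]
    refine coeff_ofPowerSums_congr fun k hk _ => ?_
    refine (coeff_ofPowerSums_map (φ.toRingHom.comp (Ψ k)) _ m).trans ?_
    refine coeff_ofPowerSums_congr fun j hj _ => ?_
    rw [powerSum_ofPowerSums _ (Nat.mul_pos hk hj), ← hmul k j hk hj]
    rfl

end LambdaRing

/-! ### Characteristic polynomials of diagonalizable endomorphisms -/

namespace LinearMap

open Module

section Exact

variable {k U V W : Type*} [Field k] [AddCommGroup U] [Module k U] [AddCommGroup V] [Module k V]
  [AddCommGroup W] [Module k W] [FiniteDimensional k V]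

theorem charpoly_eq_restrict_mul_mapQ (N : Submodule k V) (e : V →ₗ[k] V) (he : N ≤ N.comap e) :
    e.charpoly = (e.restrict he).charpoly * (N.mapQ N e he).charpoly := by
  let bW := Module.Free.chooseBasis k N
  let bQ := Module.Free.chooseBasis k (V ⧸ N)
  let b := Basis.sumQuot bW bQ
  let B : Matrix _ _ k := Matrix.of fun i l ↦ (b.repr (e (b (Sum.inr l)))) (Sum.inl i)
  suffices LinearMap.toMatrix b b e = Matrix.fromBlocks (LinearMap.toMatrix bW bW (e.restrict he))
      B 0 (LinearMap.toMatrix bQ bQ (N.mapQ N e he)) by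
    rw [← LinearMap.charpoly_toMatrix e b, this, ← LinearMap.charpoly_toMatrix _ bW,
      ← LinearMap.charpoly_toMatrix _ bQ, Matrix.charpoly_fromBlocks_zero₂₁]
  ext u v
  cases u with
  | inl i =>
    cases v with
    | inl k =>
      simp only [b, Basis.sumQuot_inl, Matrix.fromBlocks_apply₁₁, LinearMap.toMatrix_apply]
      apply Basis.sumQuot_repr_inl_of_mem
    | inr l => simp [b, LinearMap.toMatrix_apply, Matrix.fromBlocks_apply₁₂, B]
  | inr j =>
    cases v with
    | inl k =>
      suffices N.mkQ (e (bW k)) = 0 by simp [LinearMap.toMatrix_apply, b, this]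
      rw [← LinearMap.mem_ker, Submodule.ker_mkQ]
      exact he (Submodule.coe_mem (bW k))
    | inr l =>
      simp only [LinearMap.toMatrix_apply, Basis.sumQuot_repr_inr,
        Matrix.fromBlocks_apply₂₂, b]
      rw [← Basis.sumQuot_inr bW bQ l, N.mapQ_apply]
      simp

/-- The characteristic polynomial is multiplicative in short exact sequences. -/
theorem charpoly_eq_mul_of_exact [FiniteDimensional k U] [FiniteDimensional k W]
    {i : U →ₗ[k] V} {q : V →ₗ[k] W} (hi : Function.Injective i)
    (hiq : Function.Exact i q) (hq : Function.Surjective q) {f : End k U} {g : End k V}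
    {h : End k W} (hfg : g ∘ₗ i = i ∘ₗ f) (hgh : q ∘ₗ g = h ∘ₗ q) :
    g.charpoly = f.charpoly * h.charpoly := by
  have hN : q.ker ≤ q.ker.comap g := fun x hx => by
    have := LinearMap.congr_fun hgh x
    simp only [LinearMap.comp_apply, LinearMap.mem_ker.1 hx, map_zero] at this
    exact this
  have hr : LinearMap.range i = q.ker := (LinearMap.exact_iff.1 hiq).symm
  rw [charpoly_eq_restrict_mul_mapQ _ g hN]
  congr 1
  · let e : U ≃ₗ[k] q.ker := (LinearEquiv.ofInjective i hi).trans (LinearEquiv.ofEq _ _ hr)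
    rw [← LinearEquiv.charpoly_conj e f]
    congr 1
    ext x
    obtain ⟨y, rfl⟩ := e.surjective x
    rw [LinearEquiv.conj_apply_apply, e.symm_apply_apply]
    exact LinearMap.congr_fun hfg y
  · let e := q.quotKerEquivOfSurjective hq
    rw [← LinearEquiv.charpoly_conj e]
    congr 1
    ext x
    obtain ⟨y, rfl⟩ := e.surjective x
    obtain ⟨y, rfl⟩ := Submodule.mkQ_surjective _ y
    simpa [e, LinearEquiv.conj_apply] using LinearMap.congr_fun hgh y

end Exact

section Eigenbasis

variable {F V W : Type*} [Field F] [AddCommGroup V] [Module F V]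
  [AddCommGroup W] [Module F W]

theorem pow_apply_of_eigenvector {f : End F V} {v : V} {c : F} (h : f v = c • v) (n : ℕ) :
    (f ^ n) v = c ^ n • v := by
  induction n with
  | zero => simp
  | succ n ih => rw [pow_succ', Module.End.mul_apply, ih, map_smul, h, smul_smul, pow_succ]

theorem map_ιMulti_family_of_eigenbasis {ι : Type*} [LinearOrder ι] (b : Basis ι F V)
    {f : End F V} {μ : ι → F} (h : ∀ i, f (b i) = μ i • b i) (n : ℕ) (S : Set.powersetCard ι n) :
    exteriorPower.map n f (b.exteriorPower n S) = (∏ i ∈ S.1, μ i) • b.exteriorPower n S := by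
  rw [exteriorPower.basis_apply, exteriorPower.ιMulti_family, exteriorPower.map_apply_ιMulti]
  have : (⇑f ∘ b ∘ ⇑(Set.powersetCard.ofFinEmbEquiv.symm S)) = fun j =>
      μ (Set.powersetCard.ofFinEmbEquiv.symm S j) • (b ∘ ⇑(Set.powersetCard.ofFinEmbEquiv.symm S)) j :=
    funext fun j => h _
  rw [this, AlternatingMap.map_smul_univ]
  congr 1
  conv_rhs => rw [← Finset.map_orderEmbOfFin_univ S.1 S.2, Finset.prod_map]
  rfl

variable [FiniteDimensional F V] [FiniteDimensional F W]

theorem charpoly_of_eigenbasis {ι : Type*} [Fintype ι] (b : Basis ι F V) {f : End F V} {μ : ι → F}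
    (h : ∀ i, f (b i) = μ i • b i) :
    f.charpoly = ∏ i, (Polynomial.X - Polynomial.C (μ i)) := by
  classical
  rw [← LinearMap.charpoly_toMatrix f b, ← Matrix.charpoly_diagonal]
  congr 1
  ext i j
  rw [LinearMap.toMatrix_apply, h, map_smul, Basis.repr_self, Finsupp.smul_apply,
    Finsupp.single_apply, Matrix.diagonal_apply, smul_eq_mul]
  by_cases hij : i = j
  · subst hij; simp
  · simp [hij, Ne.symm hij]

theorem roots_charpoly_of_eigenbasis {ι : Type*} [Fintype ι] (b : Basis ι F V) {f : End F V}
    {μ : ι → F} (h : ∀ i, f (b i) = μ i • b i) :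
    f.charpoly.roots = Finset.univ.val.map μ := by
  rw [charpoly_of_eigenbasis b h, ← Polynomial.roots_multiset_prod_X_sub_C (Finset.univ.val.map μ),
    Multiset.map_map]
  rfl

/-- An endomorphism of finite order prime to the characteristic is diagonalizable over an
algebraically closed field. -/
theorem exists_eigenbasis [IsAlgClosed F] {f : End F V} {e : ℕ} (he : (e : F) ≠ 0)
    (hf : f ^ e = 1) :
    ∃ (b : Basis (Fin (finrank F V)) F V) (μ : Fin (finrank F V) → F),
      (∀ i, f (b i) = μ i • b i) ∧ ∀ i, μ i ^ e = 1 := by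
  classical
  have hs : f.IsSemisimple := by
    refine Module.End.isSemisimple_of_squarefree_aeval_eq_zero
      (Polynomial.separable_X_pow_sub_C (1 : F) he one_ne_zero).squarefree ?_
    simp [hf]
  have hint : DirectSum.IsInternal fun μ => f.eigenspace μ :=
    DirectSum.isInternal_submodule_of_iSupIndep_of_iSup_eq_top f.eigenspaces_iSupIndep
      hs.iSup_eigenspace_eq_top
  let b' := hint.collectedBasis fun μ => Module.Free.chooseBasis F (f.eigenspace μ)
  have : Finite (Σ μ, Module.Free.ChooseBasisIndex F (f.eigenspace μ)) :=
    Module.Finite.finite_basis b'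
  have : Fintype (Σ μ, Module.Free.ChooseBasisIndex F (f.eigenspace μ)) := Fintype.ofFinite _
  let σ := Fintype.equivFinOfCardEq (finrank_eq_card_basis b').symm
  have key : ∀ i, f (b'.reindex σ i) = (σ.symm i).1 • b'.reindex σ i := fun i => by
    rw [Basis.reindex_apply]
    exact Module.End.mem_eigenspace_iff.1 (hint.collectedBasis_mem _ _)
  refine ⟨b'.reindex σ, fun i => (σ.symm i).1, key, fun i => ?_⟩
  have h := pow_apply_of_eigenvector (key i) e
  rw [hf, Module.End.one_apply] at h
  have h0 := (b'.reindex σ).ne_zero i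
  refine (smul_left_injective F h0 ?_).symm
  simpa using h

theorem roots_charpoly_exteriorPower_map {n : ℕ} {d : ℕ} (b : Basis (Fin d) F V) {f : End F V}
    {μ : Fin d → F} (h : ∀ i, f (b i) = μ i • b i) :
    (exteriorPower.map n f).charpoly.roots =
      ((Finset.univ : Finset (Fin d)).powersetCard n).val.map fun S => ∏ i ∈ S, μ i := by
  classical
  rw [roots_charpoly_of_eigenbasis (b.exteriorPower n) (map_ιMulti_family_of_eigenbasis b h n)]
  have : (Finset.univ : Finset (Fin d)).powersetCard n =
      (Finset.univ : Finset (Set.powersetCard (Fin d) n)).map (Function.Embedding.subtype _) := by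
    ext S
    simp
  rw [this, Finset.map_val, Multiset.map_map]
  rfl

theorem roots_charpoly_tensorProduct_map {ι κ : Type*} [Fintype ι] [Fintype κ] (b : Basis ι F V)
    (c : Basis κ F W) {f : End F V} {g : End F W} {μ : ι → F} {ν : κ → F}
    (hf : ∀ i, f (b i) = μ i • b i) (hg : ∀ i, g (c i) = ν i • c i) :
    (TensorProduct.map f g).charpoly.roots =
      (Finset.univ : Finset (ι × κ)).val.map fun p => μ p.1 * ν p.2 :=
  roots_charpoly_of_eigenbasis (b.tensorProduct c) fun p => by
    rw [Basis.tensorProduct_apply, TensorProduct.map_tmul, hf, hg, TensorProduct.smul_tmul_smul]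

end Eigenbasis

section BaseChange

variable {k V W : Type*} [Field k] [AddCommGroup V] [Module k V] [AddCommGroup W] [Module k W]
  (F : Type*) [Field F] [Algebra k F]

theorem toMatrix_baseChange_self {ι : Type*} [Fintype ι] [DecidableEq ι] (b : Basis ι k V)
    (f : End k V) : LinearMap.toMatrix (b.baseChange F) (b.baseChange F) (f.baseChange F) =
      (LinearMap.toMatrix b b f).map (algebraMap k F) := by
  ext i j
  simp [LinearMap.toMatrix_apply, ← Algebra.algebraMap_eq_smul_one]

variable [FiniteDimensional k V] [FiniteDimensional k W]

theorem toMatrix_exteriorPower_map {R M : Type*} [CommRing R] [AddCommGroup M] [Module R M]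
    {ι : Type*} [LinearOrder ι] [Fintype ι] (b : Basis ι R M) (f : End R M) (n : ℕ) :
    LinearMap.toMatrix (b.exteriorPower n) (b.exteriorPower n) (exteriorPower.map n f) =
      Matrix.of fun S T => (Matrix.of fun i j => LinearMap.toMatrix b b f
        (Set.powersetCard.ofFinEmbEquiv.symm S j) (Set.powersetCard.ofFinEmbEquiv.symm T i)).det := by
  ext S T
  rw [LinearMap.toMatrix_apply, exteriorPower.basis_repr_apply, exteriorPower.basis_apply,
    exteriorPower.ιMulti_family, exteriorPower.map_apply_ιMulti,
    exteriorPower.ιMultiDual_apply_ιMulti]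
  simp [LinearMap.toMatrix_apply]

/-- The matrix of `Λ^n f` consists of minors of the matrix of `f`, so its characteristic polynomial
is compatible with base change. -/
theorem charpoly_exteriorPower_map_baseChange (f : End k V) (n : ℕ) :
    ((exteriorPower.map n f).baseChange F).charpoly =
      (exteriorPower.map n (f.baseChange F)).charpoly := by
  classical
  let b := Module.finBasis k V
  rw [LinearMap.charpoly_baseChange, ← LinearMap.charpoly_toMatrix _ (b.exteriorPower n),
    ← LinearMap.charpoly_toMatrix _ ((b.baseChange F).exteriorPower n), ← Matrix.charpoly_map,
    toMatrix_exteriorPower_map, toMatrix_exteriorPower_map, toMatrix_baseChange_self]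
  congr 1
  ext S T
  simp only [Matrix.map_apply, Matrix.of_apply, RingHom.map_det]
  rfl

theorem charpoly_tensorProduct_map_baseChange (f : End k V) (g : End k W) :
    ((TensorProduct.map f g).baseChange F).charpoly =
      LinearMap.charpoly (M := TensorProduct F (TensorProduct k F V) (TensorProduct k F W))
        (TensorProduct.map (f.baseChange F) (g.baseChange F)) := by
  classical
  let b := Module.finBasis k V
  let c := Module.finBasis k W
  rw [LinearMap.charpoly_baseChange, ← LinearMap.charpoly_toMatrix _ (b.tensorProduct c),
    ← LinearMap.charpoly_toMatrix _ ((b.baseChange F).tensorProduct (c.baseChange F)),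
    ← Matrix.charpoly_map, TensorProduct.toMatrix_map, TensorProduct.toMatrix_map,
    toMatrix_baseChange_self, toMatrix_baseChange_self]
  congr 1
  ext i j
  simp

end BaseChange

end LinearMap

/-! ### Brauer lifts of traces -/

section BrauerLift

open Module

variable {F : Type*} [Field F] {ξ : F} {ω : ℂ} {e : ℕ}

variable {k V W : Type*} [Field k] [Algebra k F] [AddCommGroup V] [Module k V]
  [FiniteDimensional k V] [AddCommGroup W] [Module k W] [FiniteDimensional k W]

/-- The Brauer lift of the trace of `f`: the sum `ω ^ k_1 + ... + ω ^ k_r`, where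
`ξ ^ k_1, ..., ξ ^ k_r` are the eigenvalues of `f` over the extension field `F` of `k`. -/
def brauerLift (ξ : F) (ω : ℂ) (f : End k V) : ℂ :=
  ((f.baseChange F).charpoly.roots.map (liftRoot ξ ω)).sum

theorem brauerLift_congr {f : End k V} {g : End k W} (h : f.charpoly = g.charpoly) :
    brauerLift ξ ω f = brauerLift ξ ω g := by
  rw [brauerLift, brauerLift, LinearMap.charpoly_baseChange, LinearMap.charpoly_baseChange, h]

theorem brauerLift_baseChange (f : End k V) :
    brauerLift (F := F) ξ ω (f.baseChange F) = brauerLift ξ ω f := by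
  unfold brauerLift
  rw [LinearMap.charpoly_baseChange F (f := f.baseChange F), Algebra.algebraMap_self,
    Polynomial.map_id]

theorem brauerLift_add {U : Type*} [AddCommGroup U] [Module k U] [FiniteDimensional k U]
    {f : End k U} {g : End k V} {h : End k W} (hc : g.charpoly = f.charpoly * h.charpoly) :
    brauerLift ξ ω g = brauerLift ξ ω f + brauerLift ξ ω h := by
  simp only [brauerLift, LinearMap.charpoly_baseChange, hc, Polynomial.map_mul]
  rw [Polynomial.roots_mul, Multiset.map_add, Multiset.sum_add]
  rw [← Polynomial.map_mul]
  exact ((f.charpoly_monic.mul h.charpoly_monic).map _).ne_zero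

theorem brauerLift_eq_sum {d : ℕ} {b : Basis (Fin d) F (TensorProduct k F V)} {f : End k V}
    {μ : Fin d → F} (h : ∀ i, f.baseChange F (b i) = μ i • b i) :
    brauerLift ξ ω f = ∑ i, liftRoot ξ ω (μ i) := by
  rw [brauerLift, LinearMap.roots_charpoly_of_eigenbasis b h, Multiset.map_map]
  rfl

/-- The trace over `F` is the sum of the eigenvalues. -/
theorem trace_baseChange_eq_sum {d : ℕ} {b : Basis (Fin d) F (TensorProduct k F V)} {f : End k V}
    {μ : Fin d → F} (h : ∀ i, f.baseChange F (b i) = μ i • b i) :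
    algebraMap k F (LinearMap.trace k V f) = ∑ i, μ i := by
  rw [← LinearMap.trace_baseChange, LinearMap.trace_eq_matrix_trace F b, Matrix.trace]
  simp [LinearMap.toMatrix_apply, h]

variable [NeZero e]

theorem liftRoot_pow (hξ : IsPrimitiveRoot ξ e) (hω : IsPrimitiveRoot ω e) (k : ℕ) :
    liftRoot ξ ω (ξ ^ k) = ω ^ k := by
  have h : ∃ j : ℕ, ξ ^ j = ξ ^ k := ⟨k, rfl⟩
  rw [liftRoot, dif_pos h, (hω.isOfFinOrder (NeZero.ne e)).pow_eq_pow_iff_modEq, ← hω.eq_orderOf,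
    hξ.eq_orderOf, ← (hξ.isOfFinOrder (NeZero.ne e)).pow_eq_pow_iff_modEq]
  exact h.choose_spec

theorem liftRoot_one (hξ : IsPrimitiveRoot ξ e) (hω : IsPrimitiveRoot ω e) :
    liftRoot ξ ω 1 = 1 := by
  simpa using liftRoot_pow hξ hω 0

theorem liftRoot_mul (hξ : IsPrimitiveRoot ξ e) (hω : IsPrimitiveRoot ω e) {x y : F}
    (hx : x ^ e = 1) (hy : y ^ e = 1) :
    liftRoot ξ ω (x * y) = liftRoot ξ ω x * liftRoot ξ ω y := by
  obtain ⟨i, -, rfl⟩ := hξ.eq_pow_of_pow_eq_one hx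
  obtain ⟨j, -, rfl⟩ := hξ.eq_pow_of_pow_eq_one hy
  rw [← pow_add, liftRoot_pow hξ hω, liftRoot_pow hξ hω, liftRoot_pow hξ hω, pow_add]

theorem liftRoot_prod (hξ : IsPrimitiveRoot ξ e) (hω : IsPrimitiveRoot ω e) {ι : Type*}
    (s : Finset ι) {x : ι → F} (hx : ∀ i, x i ^ e = 1) :
    liftRoot ξ ω (∏ i ∈ s, x i) = ∏ i ∈ s, liftRoot ξ ω (x i) := by
  classical
  induction s using Finset.induction_on with
  | empty => simpa using liftRoot_one hξ hω
  | insert a s ha ih =>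
    rw [Finset.prod_insert ha, Finset.prod_insert ha, liftRoot_mul hξ hω (hx a), ih]
    rw [← Finset.prod_pow]
    exact Finset.prod_eq_one fun i _ => hx i

theorem liftRoot_pow_apply (hξ : IsPrimitiveRoot ξ e) (hω : IsPrimitiveRoot ω e) {x : F}
    (hx : x ^ e = 1) (k : ℕ) : liftRoot ξ ω (x ^ k) = liftRoot ξ ω x ^ k := by
  simpa using liftRoot_prod hξ hω (Finset.range k) (x := fun _ => x) fun _ => hx

theorem natCast_ne_zero_of_isPrimitiveRoot (hξ : IsPrimitiveRoot ξ e) : (e : F) ≠ 0 :=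
  (hξ.neZero' (n := e)).out

variable [IsAlgClosed F]

theorem exists_eigenbasis_baseChange (hξ : IsPrimitiveRoot ξ e) {f : End k V} (hf : f ^ e = 1) :
    ∃ (d : ℕ) (b : Basis (Fin d) F (TensorProduct k F V)) (μ : Fin d → F),
      (∀ i, f.baseChange F (b i) = μ i • b i) ∧ ∀ i, μ i ^ e = 1 := by
  refine ⟨_, LinearMap.exists_eigenbasis (natCast_ne_zero_of_isPrimitiveRoot hξ) ?_⟩
  rw [← LinearMap.baseChange_pow, hf, LinearMap.baseChange_one]

/-- The Brauer lifts of the traces of the powers and of the exterior powers of an endomorphism `f`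
of finite order are the power sums and the elementary symmetric functions of the same complex
numbers `w_i`. -/
theorem exists_brauerLift_pow_exteriorPower (hξ : IsPrimitiveRoot ξ e) (hω : IsPrimitiveRoot ω e)
    {f : End k V} (hf : f ^ e = 1) :
    ∃ (d : ℕ) (w : Fin d → ℂ), (∀ n, brauerLift ξ ω (f ^ n) = ∑ i, w i ^ n) ∧
      ∀ n, brauerLift ξ ω (exteriorPower.map n f) =
        ∑ S ∈ (Finset.univ : Finset (Fin d)).powersetCard n, ∏ i ∈ S, w i := by
  obtain ⟨d, b, μ, hb, hμ⟩ := exists_eigenbasis_baseChange (F := F) hξ hf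
  refine ⟨d, fun i => liftRoot ξ ω (μ i), fun n => ?_, fun n => ?_⟩
  · rw [brauerLift_eq_sum (b := b) (μ := fun i => μ i ^ n)]
    · exact Finset.sum_congr rfl fun i _ => liftRoot_pow_apply hξ hω (hμ i) n
    · intro i
      rw [LinearMap.baseChange_pow]
      exact LinearMap.pow_apply_of_eigenvector (hb i) n
  · rw [brauerLift, LinearMap.charpoly_exteriorPower_map_baseChange,
      LinearMap.roots_charpoly_exteriorPower_map b hb, Multiset.map_map]
    exact Finset.sum_congr rfl fun S _ => liftRoot_prod hξ hω S hμ

theorem brauerLift_tensorProduct_map (hξ : IsPrimitiveRoot ξ e) (hω : IsPrimitiveRoot ω e)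
    {f : End k V} {g : End k W} (hf : f ^ e = 1) (hg : g ^ e = 1) :
    brauerLift ξ ω (TensorProduct.map f g) = brauerLift ξ ω f * brauerLift ξ ω g := by
  obtain ⟨d, b, μ, hb, hμ⟩ := exists_eigenbasis_baseChange (F := F) hξ hf
  obtain ⟨d', c, ν, hc, hν⟩ := exists_eigenbasis_baseChange (F := F) hξ hg
  rw [brauerLift_eq_sum hb, brauerLift_eq_sum hc, brauerLift,
    LinearMap.charpoly_tensorProduct_map_baseChange,
    LinearMap.roots_charpoly_tensorProduct_map b c hb hc, Multiset.map_map, Finset.sum_mul_sum,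
    ← Finset.sum_product']
  exact Finset.sum_congr rfl fun p _ => liftRoot_mul hξ hω (hμ _) (hν _)

theorem brauerLift_one (hξ : IsPrimitiveRoot ξ e) (hω : IsPrimitiveRoot ω e) :
    brauerLift ξ ω (1 : End k V) = finrank k V := by
  rw [brauerLift_eq_sum (b := finBasis F (TensorProduct k F V)) (μ := fun _ => 1)]
  · simp [liftRoot_one hξ hω]
  · intro i
    simp [LinearMap.baseChange_one]

open Polynomial in
/-- The Brauer lift of the trace and the trace itself are the values at `ω` and at `ξ` of one
polynomial with integral coefficients. -/
theorem exists_aeval_eq_brauerLift (hξ : IsPrimitiveRoot ξ e) (hω : IsPrimitiveRoot ω e)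
    {f : End k V} (hf : f ^ e = 1) :
    ∃ q : ℤ[X], aeval ω q = brauerLift ξ ω f ∧
      aeval ξ q = algebraMap k F (LinearMap.trace k V f) := by
  obtain ⟨d, b, μ, hb, hμ⟩ := exists_eigenbasis_baseChange (F := F) hξ hf
  choose m _ hm using fun i => hξ.eq_pow_of_pow_eq_one (hμ i)
  refine ⟨∑ i, X ^ m i, ?_, ?_⟩
  · rw [brauerLift_eq_sum hb]
    simp [← hm, liftRoot_pow hξ hω]
  · rw [trace_baseChange_eq_sum hb]
    simp [hm]

end BrauerLift

/-! ### The Brauer character homomorphism -/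

section BrauerHom

open CategoryTheory MonoidalCategory Module

variable {K : Type u} [Field K] {G : Type v} [Group G]

instance regularExponent_neZero [Finite G] : NeZero (regularExponent K G) := by
  refine ⟨fun h => ?_⟩
  obtain ⟨g, -, hg⟩ := Finset.lcm_eq_zero_iff.1 h
  exact (orderOf_pos g).ne' hg

theorem pow_regularExponent [Finite G] {a : G} (ha : a ∈ regularElements K G) :
    a ^ regularExponent K G = 1 :=
  orderOf_dvd_iff_pow_eq_one.1 (Finset.dvd_lcm ((Set.Finite.mem_toFinset _).2 ha))

theorem rho_pow_regularExponent [Finite G] (V : FDRep K G) {a : G}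
    (ha : a ∈ regularElements K G) : V.ρ a ^ regularExponent K G = 1 := by
  rw [← map_pow, pow_regularExponent ha, map_one]

theorem brauerCharacter_eq_brauerLift (ξ : AlgebraicClosure K) (ω : ℂ) (V : FDRep K G) (a : G) :
    brauerCharacter ξ ω V a = brauerLift ξ ω (V.ρ a) := rfl

theorem brauerCharacter_iso (ξ : AlgebraicClosure K) (ω : ℂ) {V W : FDRep K G} (i : V ≅ W) (a : G) :
    brauerCharacter ξ ω V a = brauerCharacter ξ ω W a := by
  refine brauerLift_congr ?_
  rw [FDRep.Iso.conj_ρ i a, LinearEquiv.charpoly_conj]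

theorem brauerCharacter_isConj (ξ : AlgebraicClosure K) (ω : ℂ) (V : FDRep K G) {a b : G}
    (h : IsConj a b) : brauerCharacter ξ ω V a = brauerCharacter ξ ω V b := by
  obtain ⟨c, rfl⟩ := isConj_iff.1 h
  refine brauerLift_congr ?_
  let e : V ≃ₗ[K] V := LinearEquiv.ofLinearMap (V.ρ c) (V.ρ c⁻¹)
    (by rw [← Module.End.mul_eq_comp, ← map_mul, mul_inv_cancel, map_one]; rfl)
    (by rw [← Module.End.mul_eq_comp, ← map_mul, inv_mul_cancel, map_one]; rfl)
  rw [← LinearEquiv.charpoly_conj e, map_mul, map_mul]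
  rfl

variable (ξ : AlgebraicClosure K) (ω : ℂ)

/-- The Brauer character of a module as a class function. -/
def brauerClassFunction (V : FDRep K G) : RegularClassFunctions K G :=
  ⟨fun a => brauerCharacter ξ ω V a, fun _ _ h => brauerCharacter_isConj ξ ω V h⟩

variable {ξ ω}

theorem brauerClassFunction_iso {V W : FDRep K G} (i : V ≅ W) :
    brauerClassFunction ξ ω V = brauerClassFunction ξ ω W :=
  Subtype.ext (funext fun a => brauerCharacter_iso ξ ω i a)

theorem brauerClassFunction_add_of_exact {U V W : FDRep K G} {i : U ⟶ V} {q : V ⟶ W}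
    (h : IsShortExactSeq i q) : brauerClassFunction ξ ω V =
      brauerClassFunction ξ ω U + brauerClassFunction ξ ω W := by
  refine Subtype.ext (funext fun a => ?_)
  refine brauerLift_add (LinearMap.charpoly_eq_mul_of_exact h.1 h.2.1 h.2.2 ?_ ?_)
  · exact congrArg (fun f => f.hom.hom) (i.comm a).symm
  · exact congrArg (fun f => f.hom.hom) (q.comm a)

theorem brauerClassFunction_repSum (U V : FDRep K G) : brauerClassFunction ξ ω (repSum U V) =
      brauerClassFunction ξ ω U + brauerClassFunction ξ ω V := by
  refine Subtype.ext (funext fun a => ?_)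
  exact brauerLift_add (LinearMap.charpoly_prodMap (U.ρ a) (V.ρ a))

variable [Finite G]

theorem brauerClassFunction_tensor (hξ : IsPrimitiveRoot ξ (regularExponent K G))
    (hω : IsPrimitiveRoot ω (regularExponent K G)) (V W : FDRep K G) :
    brauerClassFunction ξ ω (V ⊗ W) = brauerClassFunction ξ ω V * brauerClassFunction ξ ω W :=
  Subtype.ext (funext fun a => brauerLift_tensorProduct_map hξ hω
    (rho_pow_regularExponent V a.2) (rho_pow_regularExponent W a.2))

theorem brauerClassFunction_unit (hξ : IsPrimitiveRoot ξ (regularExponent K G))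
    (hω : IsPrimitiveRoot ω (regularExponent K G)) :
    brauerClassFunction ξ ω (𝟙_ (FDRep K G)) = 1 := by
  refine Subtype.ext (funext fun a => ?_)
  refine (brauerLift_one (k := K) (V := K) hξ hω).trans ?_
  simp

/-- The Brauer character as a homomorphism on isomorphism classes of modules. -/
def brauerMonoidHom (hξ : IsPrimitiveRoot ξ (regularExponent K G))
    (hω : IsPrimitiveRoot ω (regularExponent K G)) : RepClass K G →* RegularClassFunctions K G where
  toFun s := brauerClassFunction ξ ω ((fromSkeleton _).obj s)
  map_one' := by
    rw [Skeleton.one_eq, ← brauerClassFunction_unit hξ hω]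
    exact brauerClassFunction_iso (fromSkeletonToSkeletonIso _)
  map_mul' s t := by
    rw [Skeleton.mul_eq, ← brauerClassFunction_tensor hξ hω]
    exact brauerClassFunction_iso (fromSkeletonToSkeletonIso _)

theorem brauerMonoidHom_toSkeleton (hξ : IsPrimitiveRoot ξ (regularExponent K G))
    (hω : IsPrimitiveRoot ω (regularExponent K G)) (V : FDRep K G) :
    brauerMonoidHom hξ hω (toSkeleton V) = brauerClassFunction ξ ω V :=
  brauerClassFunction_iso (fromSkeletonToSkeletonIso _)

/-- The Brauer character as a homomorphism on the Green ring. -/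
def brauerGreenRingHom (hξ : IsPrimitiveRoot ξ (regularExponent K G))
    (hω : IsPrimitiveRoot ω (regularExponent K G)) : GreenRing K G →+* RegularClassFunctions K G :=
  Ideal.Quotient.lift (greenRelations K G)
    (MonoidAlgebra.lift ℤ (RegularClassFunctions K G) (RepClass K G)
      (brauerMonoidHom hξ hω)).toRingHom (by
    intro x hx
    refine (Ideal.span_le (I := RingHom.ker _)).2 ?_ hx
    rintro _ ⟨U, V, rfl⟩
    rw [SetLike.mem_coe, RingHom.mem_ker]
    simp [brauerMonoidHom_toSkeleton, brauerClassFunction_repSum])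

/-- The Brauer character as a homomorphism on the Green algebra. -/
def brauerGreenHom (hξ : IsPrimitiveRoot ξ (regularExponent K G))
    (hω : IsPrimitiveRoot ω (regularExponent K G)) :
    GreenAlgebra K G →ₐ[ℂ] RegularClassFunctions K G :=
  Algebra.TensorProduct.lift (Algebra.ofId ℂ _) (brauerGreenRingHom hξ hω).toIntAlgHom
    (fun _ _ => Commute.all _ _)

theorem brauerGreenHom_greenClass (hξ : IsPrimitiveRoot ξ (regularExponent K G))
    (hω : IsPrimitiveRoot ω (regularExponent K G)) (V : FDRep K G) :
    brauerGreenHom hξ hω (greenClass V) = brauerClassFunction ξ ω V := by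
  refine (Algebra.TensorProduct.lift_tmul _ _ _ _ _).trans ?_
  rw [map_one, one_mul, ← brauerMonoidHom_toSkeleton hξ hω]
  refine (Ideal.Quotient.lift_mk _ _ _).trans ?_
  simp

/-- The Brauer character as a homomorphism on the Grothendieck algebra. -/
def brauerHom (hξ : IsPrimitiveRoot ξ (regularExponent K G))
    (hω : IsPrimitiveRoot ω (regularExponent K G)) :
    GrothendieckAlgebra K G →ₐ[ℂ] RegularClassFunctions K G :=
  Ideal.Quotient.liftₐ (exactRelations K G) (brauerGreenHom hξ hω) (by
    intro x hx
    refine (Ideal.span_le (I := RingHom.ker (brauerGreenHom hξ hω))).2 ?_ hx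
    rintro _ ⟨U, V, W, i, q, h, rfl⟩
    rw [SetLike.mem_coe, RingHom.mem_ker, map_sub, map_sub]
    simp only [brauerGreenHom_greenClass]
    rw [brauerClassFunction_add_of_exact h]
    simp)

theorem brauerHom_grothendieckClass (hξ : IsPrimitiveRoot ξ (regularExponent K G))
    (hω : IsPrimitiveRoot ω (regularExponent K G)) (V : FDRep K G) :
    brauerHom hξ hω (grothendieckClass V) = brauerClassFunction ξ ω V :=
  brauerGreenHom_greenClass hξ hω V

end BrauerHom

/-! ### Density for families of simple modules -/

section Density

open Module

/-- Jacobson density for pairwise non-isomorphic simple modules: additive endomorphisms `u i`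
commuting with all module endomorphisms are simultaneously given, on finite sets, by the action of a
single ring element. -/
theorem exists_smul_eq_of_pairwise_not_iso {R : Type*} [Ring R] {ι : Type*} [Fintype ι]
    {T : ι → Type*} [∀ i, AddCommGroup (T i)] [∀ i, Module R (T i)] [∀ i, IsSimpleModule R (T i)]
    (hT : ∀ i j, i ≠ j → IsEmpty (T i ≃ₗ[R] T j)) (u : ∀ i, T i →+ T i)
    (hu : ∀ i (φ : End R (T i)) (x : T i), u i (φ x) = φ (u i x)) (s : ∀ i, Finset (T i)) :
    ∃ r : R, ∀ i, ∀ x ∈ s i, r • x = u i x := by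
  classical
  have hzero : ∀ i j, j ≠ i → ∀ (φ : End R (∀ i, T i)) (x : T j), φ (Pi.single j x) i = 0 := by
    intro i j hij φ x
    let ψ : T j →ₗ[R] T i := LinearMap.proj i ∘ₗ φ ∘ₗ LinearMap.single R T j
    rcases LinearMap.bijective_or_eq_zero ψ with h | h
    · exact ((hT j i hij).false (LinearEquiv.ofBijective ψ h)).elim
    · exact LinearMap.congr_fun h x
  have hdiag : ∀ i (φ : End R (∀ i, T i)) (m : ∀ i, T i), φ m i = φ (Pi.single i (m i)) i := by
    intro i φ m
    conv_lhs => rw [← Finset.univ_sum_single m, map_sum, Finset.sum_apply]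
    exact Finset.sum_eq_single i (fun j _ hj => hzero i j hj φ (m j)) (by simp)
  let f : End (End R (∀ i, T i)) (∀ i, T i) :=
    { toFun := fun m i => u i (m i)
      map_add' := fun m m' => funext fun i => map_add (u i) _ _
      map_smul' := fun φ m => funext fun i => by
        let ψ : End R (T i) := LinearMap.proj i ∘ₗ φ ∘ₗ LinearMap.single R T i
        exact (congrArg (u i) (hdiag i φ m)).trans
          ((hu i ψ (m i)).trans (hdiag i φ (fun i => u i (m i))).symm) }
  obtain ⟨r, hr⟩ := jacobson_density f
    (Finset.univ.biUnion fun i => (s i).image fun x => (Pi.single i x : ∀ i, T i))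
  refine ⟨r, fun i x hx => ?_⟩
  have := congrFun (hr (Pi.single i x) (Finset.mem_biUnion.2
    ⟨i, Finset.mem_univ i, Finset.mem_image_of_mem _ hx⟩)) i
  simpa [f] using this.symm

variable {k R : Type*} [Field k] [Ring R] [Algebra k R] {ι : Type*} [Fintype ι]
  {T : ι → Type*} [∀ i, AddCommGroup (T i)] [∀ i, Module k (T i)] [∀ i, Module R (T i)]
  [∀ i, IsScalarTower k R (T i)] [∀ i, FiniteDimensional k (T i)] [∀ i, IsSimpleModule R (T i)]

theorem exists_lsmul_eq_of_pairwise_not_iso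
    (hT : ∀ i j, i ≠ j → IsEmpty (T i ≃ₗ[R] T j)) (u : ∀ i, End k (T i))
    (hu : ∀ i (φ : End R (T i)) (x : T i), u i (φ x) = φ (u i x)) :
    ∃ r : R, ∀ i (x : T i), r • x = u i x := by
  classical
  obtain ⟨r, hr⟩ := exists_smul_eq_of_pairwise_not_iso hT (fun i => (u i).toAddMonoidHom) hu
    fun i => Finset.univ.image (finBasis k (T i))
  refine ⟨r, fun i x => ?_⟩
  suffices Algebra.lsmul k k (T i) r = u i from LinearMap.congr_fun this x
  refine (finBasis k (T i)).ext fun j => hr i _ (Finset.mem_image_of_mem _ (Finset.mem_univ j))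

/-- A ring element acting as the identity on one simple module and as zero on the others. -/
theorem exists_smul_eq_ite [DecidableEq ι] (hT : ∀ i j, i ≠ j → IsEmpty (T i ≃ₗ[R] T j)) (i : ι) :
    ∃ r : R, ∀ j, Algebra.lsmul k k (T j) r = if j = i then 1 else 0 := by
  obtain ⟨r, hr⟩ := exists_lsmul_eq_of_pairwise_not_iso (k := k) hT
    (fun j => if j = i then 1 else 0) (fun j φ x => by split_ifs <;> simp)
  exact ⟨r, fun j => LinearMap.ext fun x => hr j x⟩

/-- Over an algebraically closed field, the traces on pairwise non-isomorphic simple modules are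
separated by elements of the algebra. -/
theorem exists_trace_lsmul_eq_ite [IsAlgClosed k] [DecidableEq ι]
    (hT : ∀ i j, i ≠ j → IsEmpty (T i ≃ₗ[R] T j)) (i : ι) :
    ∃ r : R, ∀ j, LinearMap.trace k (T j) (Algebra.lsmul k k (T j) r) = if j = i then 1 else 0 := by
  have htr : ∃ u : End k (T i), LinearMap.trace k (T i) u = 1 := by
    have := IsSimpleModule.nontrivial R (T i)
    let b := finBasis k (T i)
    let m : Fin (finrank k (T i)) := ⟨0, finrank_pos⟩
    refine ⟨(b.coord m).smulRight (b m), ?_⟩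
    rw [LinearMap.trace_smulRight]
    simp
  obtain ⟨u, hu⟩ := htr
  obtain ⟨r, hr⟩ := exists_lsmul_eq_of_pairwise_not_iso (k := k) hT
    (Function.update (fun j => (0 : End k (T j))) i u) (fun j φ x => by
      obtain ⟨c, rfl⟩ := (IsSimpleModule.algebraMap_end_bijective_of_isAlgClosed k).2 φ
      simp [Module.algebraMap_end_apply])
  refine ⟨r, fun j => ?_⟩
  have : Algebra.lsmul k k (T j) r = Function.update (fun j => (0 : End k (T j))) i u j :=
    LinearMap.ext fun x => hr j x
  rw [this]
  obtain rfl | h := eq_or_ne j i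
  · simp [hu]
  · simp [h]

end Density

/-! ### Lifting linear independence from positive characteristic -/

section Lifting

open Polynomial Module

/-- Linearly independent functions remain so on suitably chosen points, where they form an
invertible matrix. -/
theorem LinearIndependent.exists_det_ne_zero {F X ι : Type*} [Field F] [Fintype ι] [DecidableEq ι]
    {f : ι → X → F} (hf : LinearIndependent F f) :
    ∃ x : ι → X, (Matrix.of fun i j => f i (x j)).det ≠ 0 := by
  let c : X → ι → F := fun x i => f i x
  have hspan : Submodule.span F (Set.range c) = ⊤ := by
    by_contra h
    obtain ⟨φ, hφ, hle⟩ := Submodule.exists_le_ker_of_lt_top _ (lt_top_iff_ne_top.2 h)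
    refine hφ ?_
    have hφs : ∀ v : ι → F, φ v = ∑ i, v i * φ (Pi.single i 1) := fun v => by
      conv_lhs => rw [← Finset.univ_sum_single v, map_sum]
      refine Finset.sum_congr rfl fun i _ => ?_
      rw [← smul_eq_mul, ← map_smul, ← Pi.single_smul, smul_eq_mul, mul_one]
    have h0 := Fintype.linearIndependent_iff.1 hf (fun i => φ (Pi.single i 1)) (by
      funext x
      have : φ (c x) = 0 := hle (Submodule.subset_span ⟨x, rfl⟩)
      rw [hφs] at this
      simpa [c, mul_comm] using this)
    refine LinearMap.ext fun v => ?_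
    rw [hφs]
    simp [h0]
  obtain ⟨b, hb, hbs, hbl⟩ := exists_linearIndependent F (Set.range c)
  have : Finite b := hbl.finite
  have : Fintype b := Fintype.ofFinite _
  let B : Basis b F (ι → F) := Basis.mk hbl (by
    rw [Subtype.range_coe, hbs, hspan])
  let σ : ι ≃ b := Fintype.equivOfCardEq (by
    rw [← finrank_eq_card_basis B, finrank_fintype_fun_eq_card])
  choose x hx using fun j : ι => hb (σ j).2
  refine ⟨x, ?_⟩
  have hcol : LinearIndependent F (fun j => c (x j)) := by
    simp only [hx]
    exact hbl.comp σ σ.injective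
  have := Matrix.linearIndependent_rows_iff_isUnit.1
    (show LinearIndependent F (Matrix.of fun i j => f i (x j)).transpose.row from hcol)
  rw [Matrix.isUnit_transpose, Matrix.isUnit_iff_isUnit_det] at this
  exact this.ne_zero

theorem det_aeval {S ι : Type*} [CommRing S] [Fintype ι] [DecidableEq ι] (s : S)
    (m : ι → ι → ℤ[X]) : (Matrix.of fun i j => aeval s (m i j)).det =
      aeval s (Matrix.of fun i j => m i j).det :=
  (RingHom.map_det (aeval s : ℤ[X] →ₐ[ℤ] S).toRingHom (Matrix.of fun i j => m i j)).symm

/-- If functions over a field `F` are linearly independent and arise by evaluating integral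
polynomials at a root of unity, then the functions obtained by evaluation at a complex root of unity
of the same order are linearly independent: an integral minor that vanishes at `ω` is divisible by
the cyclotomic polynomial and hence vanishes at `ξ`. -/
theorem LinearIndependent.of_aeval_primitiveRoot {F X ι : Type*} [Field F] [Fintype ι] {e : ℕ}
    [NeZero e] {ξ : F} {ω : ℂ} (hξ : IsPrimitiveRoot ξ e) (hω : IsPrimitiveRoot ω e)
    (q : ι → X → ℤ[X]) (h : LinearIndependent F fun i x => aeval ξ (q i x)) :
    LinearIndependent ℂ fun i x => aeval ω (q i x) := by
  classical
  obtain ⟨x, hx⟩ := h.exists_det_ne_zero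
  have key : (Matrix.of fun i j => aeval ω (q i (x j))).det ≠ 0 := by
    intro h0
    refine hx ?_
    rw [det_aeval _ fun i j => q i (x j)] at h0 ⊢
    have hdvd := minpoly.isIntegrallyClosed_dvd (hω.isIntegral (NeZero.pos e)) h0
    rw [← cyclotomic_eq_minpoly hω (NeZero.pos e)] at hdvd
    refine aeval_eq_zero_of_dvd_aeval_eq_zero hdvd ?_
    have := hξ.isRoot_cyclotomic (NeZero.pos e)
    rwa [IsRoot.def, ← map_cyclotomic_int, eval_map, ← algebraMap_int_eq, ← aeval_def] at this
  have hrows : LinearIndependent ℂ (Matrix.of fun i j => aeval ω (q i (x j))).row :=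
    Matrix.linearIndependent_rows_iff_isUnit.2
      ((Matrix.isUnit_iff_isUnit_det _).2 key.isUnit)
  exact LinearIndependent.of_comp (LinearMap.funLeft ℂ ℂ x) hrows

end Lifting

/-! ### Traces and regular elements -/

section RegularPart

open Module

/-- Some power of `g` is a `p`-regular element `h` with `h ^ (p ^ a) = g ^ (p ^ a)`. -/
theorem exists_pow_regular {G : Type*} [Group G] [Finite G] {p : ℕ} (hp : p.Prime) (g : G) :
    ∃ n a : ℕ, ¬ p ∣ orderOf (g ^ n) ∧ (g ^ n) ^ p ^ a = g ^ p ^ a := by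
  obtain ⟨a, m, hm, hg⟩ := Nat.exists_eq_pow_mul_and_not_dvd (orderOf_pos g).ne' p hp.ne_one
  have hm0 : m ≠ 0 := by
    rintro rfl
    exact hm (dvd_zero p)
  have hcop : (p ^ a).Coprime m := Nat.Coprime.pow_left a ((Nat.Prime.coprime_iff_not_dvd hp).2 hm)
  refine ⟨(p ^ a) ^ m.totient, a, fun hdvd => hm (hdvd.trans (orderOf_dvd_of_pow_eq_one ?_)), ?_⟩
  · rw [← pow_mul]
    refine orderOf_dvd_iff_pow_eq_one.1 ?_
    rw [hg]
    exact mul_dvd_mul_right (dvd_pow_self _ (Nat.totient_pos.2 (Nat.pos_of_ne_zero hm0)).ne') m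
  · rw [← pow_mul, pow_eq_pow_iff_modEq, hg, mul_comm, mul_comm]
    have := (Nat.ModEq.pow_totient hcop).mul_left' (p ^ a)
    rwa [mul_one, mul_comm (p ^ a) ((p ^ a) ^ _)] at this

/-- In characteristic `p`, commuting endomorphisms with the same `p ^ a`-th power have the same
trace, since their difference is nilpotent. -/
theorem trace_eq_of_pow_char_pow_eq {k V : Type*} [Field k] {p : ℕ} [Fact p.Prime] [CharP k p]
    [AddCommGroup V] [Module k V] {f g : End k V} (hc : Commute f g) {a : ℕ}
    (h : f ^ p ^ a = g ^ p ^ a) : LinearMap.trace k V f = LinearMap.trace k V g := by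
  rcases subsingleton_or_nontrivial V with _ | _
  · rw [Subsingleton.elim f g]
  have := charP_of_injective_algebraMap (FaithfulSMul.algebraMap_injective k (End k V)) p
  have hn : IsNilpotent (f - g) := ⟨p ^ a, by rw [sub_pow_char_pow_of_commute p a hc, h, sub_self]⟩
  have := (LinearMap.isNilpotent_trace_of_isNilpotent hn).eq_zero
  rwa [map_sub, sub_eq_zero] at this

end RegularPart

/-! ### Constructions with finite-dimensional representations -/

section Reps

open CategoryTheory Representation Module

variable {k : Type u} [Field k] {G : Type v} [Group G]

/-- The homomorphism of representations given by an equivariant linear map. -/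
def repHomOfLinear {U V : FDRep k G} (f : U →ₗ[k] V) (h : ∀ g, V.ρ g ∘ₗ f = f ∘ₗ U.ρ g) : U ⟶ V :=
  ⟨InducedCategory.homMk (ModuleCat.ofHom f), fun g ↦ by
    ext x
    exact (LinearMap.congr_fun (h g) x).symm⟩

theorem repHomToLinear_comm {U V : FDRep k G} (f : U ⟶ V) (g : G) :
    V.ρ g ∘ₗ repHomToLinear f = repHomToLinear f ∘ₗ U.ρ g :=
  congrArg (fun f => f.hom.hom) (f.comm g).symm

theorem repHomToLinear_asAlgebraHom {U V : FDRep k G} (f : U ⟶ V) (r : MonoidAlgebra k G) (x : U) :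
    repHomToLinear f (asAlgebraHom U.ρ r x) = asAlgebraHom V.ρ r (repHomToLinear f x) := by
  induction r using MonoidAlgebra.induction_linear with
  | zero => simp
  | add a b ha hb => simp [ha, hb]
  | single g c =>
    rw [asAlgebraHom_single, asAlgebraHom_single, LinearMap.smul_apply, LinearMap.smul_apply,
      map_smul]
    exact congrArg (c • ·) (LinearMap.congr_fun (repHomToLinear_comm f g) x).symm

/-- The isomorphism of representations given by an equivariant linear equivalence. -/
def repIsoOfLinear {U V : FDRep k G} (f : U ≃ₗ[k] V)
    (h : ∀ g, V.ρ g ∘ₗ f.toLinearMap = f.toLinearMap ∘ₗ U.ρ g) : U ≅ V where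
  hom := repHomOfLinear f.toLinearMap h
  inv := repHomOfLinear f.symm.toLinearMap fun g => by
    ext x
    have := LinearMap.congr_fun (h g) (f.symm x)
    simp at this
    simp [this]
  hom_inv_id := by
    ext x
    exact f.symm_apply_apply x
  inv_hom_id := by
    ext x
    exact f.apply_symm_apply x

/-- An isomorphism of the modules over the group algebra is one of representations. -/
def repIsoOfAsModule {U V : FDRep k G} (f : asModule U.ρ ≃ₗ[MonoidAlgebra k G] asModule V.ρ) :
    U ≅ V :=
  repIsoOfLinear (f.restrictScalars k) fun g => LinearMap.ext fun y => by
    obtain ⟨x, rfl⟩ := (asModuleEquiv U.ρ).surjective y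
    have := f.map_smul (MonoidAlgebra.single g 1) x
    rw [Representation.single_smul, Representation.single_smul, one_smul, one_smul] at this
    exact this.symm

/-- A property of representations that holds for irreducible ones and is inherited by extensions
holds for all. -/
theorem FDRep.induction_irreducible {P : FDRep k G → Prop} (zero : ∀ V : FDRep k G,
    Subsingleton V → P V) (irred : ∀ V : FDRep k G, IsIrreducible V.ρ → P V)
    (ext : ∀ (U V W : FDRep k G) (i : U ⟶ V) (q : V ⟶ W), IsShortExactSeq i q → P U → P W → P V)
    (V : FDRep k G) : P V := by
  induction h : finrank k V using Nat.strong_induction_on generalizing V with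
  | _ n ih =>
    subst h
    by_cases hs : Subsingleton V
    · exact zero V hs
    by_cases hV : IsIrreducible V.ρ
    · exact irred V hV
    have hne : Nontrivial V := not_subsingleton_iff_nontrivial.1 hs
    have : Nontrivial (Subrepresentation V.ρ) := by
      refine ⟨⟨⊥, ⊤, fun h => ?_⟩⟩
      have := congrArg Subrepresentation.toSubmodule h
      exact bot_ne_top (α := Submodule k V) this
    obtain ⟨N, hN0, hN1⟩ : ∃ N : Subrepresentation V.ρ, N ≠ ⊥ ∧ N ≠ ⊤ := by
      by_contra hcon
      push Not at hcon
      exact hV ⟨fun N => or_iff_not_imp_left.2 (hcon N)⟩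
    have hN0' : N.toSubmodule ≠ ⊥ := fun h => hN0 (Subrepresentation.toSubmodule_injective h)
    have hN1' : N.toSubmodule ≠ ⊤ := fun h => hN1 (Subrepresentation.toSubmodule_injective h)
    let U : FDRep k G := FDRep.of N.toRepresentation
    let W : FDRep k G := FDRep.of (Representation.quotient V.ρ N.toSubmodule fun g => N.apply_mem_toSubmodule g)
    have hlt := Submodule.finrank_lt hN1'
    have hq := N.toSubmodule.finrank_quotient_add_finrank
    have hpos : 0 < finrank k N.toSubmodule :=
      Submodule.one_le_finrank_iff.2 hN0'
    refine ext U V W (repHomOfLinear (U := U) N.toSubmodule.subtype fun g => rfl)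
      (repHomOfLinear (U := V) (V := W) N.toSubmodule.mkQ fun g => rfl) ⟨?_, ?_, ?_⟩
      (ih _ hlt U rfl) (ih _ ?_ W rfl)
    · exact N.toSubmodule.injective_subtype
    · exact LinearMap.exact_subtype_mkQ N.toSubmodule
    · exact N.toSubmodule.mkQ_surjective
    · change finrank k (V ⧸ N.toSubmodule) < _
      lia

end Reps

/-! ### Linear independence of Brauer characters -/

section LinearIndependence

open CategoryTheory Representation Module

variable {K : Type u} [Field K] {G : Type v} [Group G]

/-- The Brauer character of a representation over the algebraic closure, as a function on the
`p`-regular elements. -/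
def closureBrauer (ξ : AlgebraicClosure K) (ω : ℂ) (V : FDRep (AlgebraicClosure K) G) :
    regularElements K G → ℂ :=
  fun a => brauerLift (F := AlgebraicClosure K) ξ ω (V.ρ a)

/-- Extension of scalars of a representation to the algebraic closure. -/
def repBaseChange (V : FDRep K G) : FDRep (AlgebraicClosure K) G :=
  FDRep.of (V := TensorProduct K (AlgebraicClosure K) V)
    { toFun := fun g => (V.ρ g).baseChange (AlgebraicClosure K)
      map_one' := by rw [map_one, LinearMap.baseChange_one]
      map_mul' := fun g h => by rw [map_mul, LinearMap.baseChange_mul] }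

variable {ξ : AlgebraicClosure K} {ω : ℂ}

theorem closureBrauer_repBaseChange (V : FDRep K G) (a : regularElements K G) :
    closureBrauer ξ ω (repBaseChange V) a = brauerCharacter ξ ω V a :=
  brauerLift_baseChange (V.ρ a)

theorem closureBrauer_iso {V W : FDRep (AlgebraicClosure K) G} (i : V ≅ W) :
    closureBrauer ξ ω V = closureBrauer ξ ω W := by
  funext a
  refine brauerLift_congr ?_
  rw [FDRep.Iso.conj_ρ i, LinearEquiv.charpoly_conj]

theorem closureBrauer_add_of_exact {U V W : FDRep (AlgebraicClosure K) G} {i : U ⟶ V} {q : V ⟶ W}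
    (h : IsShortExactSeq i q) :
    closureBrauer ξ ω V = closureBrauer ξ ω U + closureBrauer ξ ω W := by
  funext a
  exact brauerLift_add (LinearMap.charpoly_eq_mul_of_exact h.1 h.2.1 h.2.2
    (repHomToLinear_comm i a) (repHomToLinear_comm q a).symm)

theorem exists_asAlgebraHom_repBaseChange (r : MonoidAlgebra K G) :
    ∃ r' : MonoidAlgebra (AlgebraicClosure K) G, ∀ V : FDRep K G,
      asAlgebraHom (repBaseChange V).ρ r' =
        (asAlgebraHom V.ρ r).baseChange (AlgebraicClosure K) := by
  induction r using MonoidAlgebra.induction_linear with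
  | zero => exact ⟨0, fun V => by
      rw [map_zero, map_zero]
      exact LinearMap.baseChange_zero.symm⟩
  | add a b ha hb =>
    obtain ⟨a', ha⟩ := ha
    obtain ⟨b', hb⟩ := hb
    exact ⟨a' + b', fun V => by
      rw [map_add, map_add, ha, hb]
      exact (LinearMap.baseChange_add _ _).symm⟩
  | single g t =>
    refine ⟨MonoidAlgebra.single g (algebraMap K _ t), fun V => ?_⟩
    rw [asAlgebraHom_single, asAlgebraHom_single, LinearMap.baseChange_smul]
    exact algebraMap_smul _ t ((V.ρ g).baseChange (AlgebraicClosure K))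

variable [Finite G]

/-- Every element of `G` has a `p`-regular power with the same trace in all representations. -/
theorem exists_pow_mem_regularElements_trace_eq (g : G) :
    ∃ n : ℕ, g ^ n ∈ regularElements K G ∧ ∀ V : FDRep (AlgebraicClosure K) G,
      LinearMap.trace _ _ (V.ρ (g ^ n)) = LinearMap.trace _ _ (V.ρ g) := by
  by_cases h0 : ringChar K = 0
  · refine ⟨1, fun h => ?_, fun V => by rw [pow_one]⟩
    rw [h0, zero_dvd_iff] at h
    exact (orderOf_pos _).ne' h
  · have hp : (ringChar K).Prime := CharP.char_prime_of_ne_zero K h0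
    have : Fact (ringChar K).Prime := ⟨hp⟩
    have : CharP (AlgebraicClosure K) (ringChar K) :=
      charP_of_injective_algebraMap (FaithfulSMul.algebraMap_injective K _) _
    obtain ⟨n, a, hn, ha⟩ := exists_pow_regular hp g
    refine ⟨n, hn, fun V => trace_eq_of_pow_char_pow_eq (p := ringChar K) (a := a) ?_ ?_⟩
    · rw [map_pow]
      exact Commute.pow_left (Commute.refl _) n
    · rw [← map_pow, ha, map_pow]

/-- Over the algebraic closure, the Brauer characters of pairwise non-isomorphic irreducible
representations are linearly independent. -/
theorem linearIndependent_closureBrauer (hξ : IsPrimitiveRoot ξ (regularExponent K G))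
    (hω : IsPrimitiveRoot ω (regularExponent K G)) {ι : Type*} [Fintype ι]
    (V : ι → FDRep (AlgebraicClosure K) G) (hV : ∀ i, IsIrreducible (V i).ρ)
    (hne : ∀ i j, i ≠ j → IsEmpty (V i ≅ V j)) :
    LinearIndependent ℂ fun i => closureBrauer ξ ω (V i) := by
  classical
  have hpow : ∀ i (a : regularElements K G), (V i).ρ a ^ regularExponent K G = 1 := fun i a => by
    rw [← map_pow, pow_regularExponent a.2, map_one]
  choose q hq hq' using fun i a => exists_aeval_eq_brauerLift hξ hω (hpow i a)
  have e1 : (fun i => closureBrauer ξ ω (V i)) = fun i a => Polynomial.aeval ω (q i a) :=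
    funext fun i => funext fun a => (hq i a).symm
  rw [e1]
  refine LinearIndependent.of_aeval_primitiveRoot hξ hω q ?_
  simp only [hq', Algebra.algebraMap_self, RingHom.id_apply]
  rw [Fintype.linearIndependent_iff]
  intro c hc i
  have h1 : ∀ g : G, ∑ j, c j * LinearMap.trace _ _ ((V j).ρ g) = 0 := by
    intro g
    obtain ⟨n, hn, htr⟩ := exists_pow_mem_regularElements_trace_eq (K := K) g
    have h := congrFun hc ⟨g ^ n, hn⟩
    simp only [Finset.sum_apply, Pi.smul_apply, smul_eq_mul, Pi.zero_apply, htr] at h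
    exact h
  have h2 : ∀ r : MonoidAlgebra (AlgebraicClosure K) G,
      ∑ j, c j * LinearMap.trace _ _ (asAlgebraHom (V j).ρ r) = 0 := by
    intro r
    induction r using MonoidAlgebra.induction_linear with
    | zero => simp
    | add a b ha hb => simp [mul_add, Finset.sum_add_distrib, ha, hb]
    | single g t =>
      have : ∑ j, c j * (t * LinearMap.trace _ _ ((V j).ρ g)) = 0 := by
        simp only [mul_left_comm _ t]
        rw [← Finset.mul_sum, h1, mul_zero]
      simpa [asAlgebraHom_single] using this
  have : ∀ i, IsSimpleModule (MonoidAlgebra (AlgebraicClosure K) G) (asModule (V i).ρ) :=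
    fun i => (irreducible_iff_isSimpleModule_asModule _).1 (hV i)
  obtain ⟨r, hr⟩ := exists_trace_lsmul_eq_ite (k := AlgebraicClosure K)
    (R := MonoidAlgebra (AlgebraicClosure K) G) (T := fun i => asModule (V i).ρ)
    (fun i j hij => ⟨fun f => (hne i j hij).false (repIsoOfAsModule f)⟩) i
  have hr' : ∀ j, LinearMap.trace _ _ (asAlgebraHom (V j).ρ r) = if j = i then 1 else 0 := hr
  simpa [hr'] using h2 r

/-- The Brauer character of a representation over the algebraic closure is a combination of Brauer
characters of irreducible representations on which every group algebra element acting as a scalar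
on the given representation acts as the same scalar. -/
theorem closureBrauer_mem_span (hξ : IsPrimitiveRoot ξ (regularExponent K G))
    (hω : IsPrimitiveRoot ω (regularExponent K G)) (M : FDRep (AlgebraicClosure K) G) :
    closureBrauer ξ ω M ∈ Submodule.span ℂ {φ | ∃ T : FDRep (AlgebraicClosure K) G,
      IsIrreducible T.ρ ∧ (∀ r (c : AlgebraicClosure K), asAlgebraHom M.ρ r = c • 1 →
        asAlgebraHom T.ρ r = c • 1) ∧ φ = closureBrauer ξ ω T} := by
  induction M using FDRep.induction_irreducible with
  | zero V h =>
    have : closureBrauer ξ ω V = 0 := by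
      funext a
      have h1 : V.ρ a = 1 := LinearMap.ext fun x => Subsingleton.elim _ _
      rw [closureBrauer, h1, brauerLift_one hξ hω, finrank_zero_of_subsingleton]
      simp
    rw [this]
    exact zero_mem _
  | irred V h => exact Submodule.subset_span ⟨V, h, fun _ _ h => h, rfl⟩
  | ext U V W i q h hU hW =>
    rw [closureBrauer_add_of_exact h]
    refine add_mem (Submodule.span_mono ?_ hU) (Submodule.span_mono ?_ hW)
    · rintro _ ⟨T, hT, hc, rfl⟩
      refine ⟨T, hT, fun r c hr => hc r c (LinearMap.ext fun x => h.1 ?_), rfl⟩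
      rw [repHomToLinear_asAlgebraHom, hr]
      simp
    · rintro _ ⟨T, hT, hc, rfl⟩
      refine ⟨T, hT, fun r c hr => hc r c (LinearMap.ext fun x => ?_), rfl⟩
      obtain ⟨y, rfl⟩ := h.2.2 x
      rw [← repHomToLinear_asAlgebraHom, hr]
      simp

/-- The Brauer characters of pairwise non-isomorphic irreducible representations over any field are
linearly independent: the composition factors of their extensions to the algebraic closure are
distinguished by elements of the group algebra over `K`. -/
theorem linearIndependent_brauerCharacter (hξ : IsPrimitiveRoot ξ (regularExponent K G))
    (hω : IsPrimitiveRoot ω (regularExponent K G)) {ι : Type*} [Fintype ι] (S : ι → FDRep K G)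
    (hS : ∀ i, IsIrreducible (S i).ρ) (hne : ∀ i j, i ≠ j → IsEmpty (S i ≅ S j)) :
    LinearIndependent ℂ fun i (a : regularElements K G) => brauerCharacter ξ ω (S i) a := by
  classical
  have e1 : (fun i (a : regularElements K G) => brauerCharacter ξ ω (S i) a) =
      fun i => closureBrauer ξ ω (repBaseChange (S i)) :=
    funext fun i => funext fun a => (closureBrauer_repBaseChange (S i) a).symm
  rw [e1]
  have : ∀ i, IsSimpleModule (MonoidAlgebra K G) (asModule (S i).ρ) :=
    fun i => (irreducible_iff_isSimpleModule_asModule _).1 (hS i)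
  choose r hr using exists_smul_eq_ite (k := K)
    (R := MonoidAlgebra K G) (T := fun i => asModule (S i).ρ)
    (fun i j hij => ⟨fun f => (hne i j hij).false (repIsoOfAsModule f)⟩)
  have hr' : ∀ i j, asAlgebraHom (S j).ρ (r i) = if j = i then 1 else 0 := hr
  choose r' hr'' using fun i => exists_asAlgebraHom_repBaseChange (r i)
  have hact : ∀ i j, asAlgebraHom (repBaseChange (S j)).ρ (r' i) =
      (if j = i then 1 else 0 : AlgebraicClosure K) • 1 := fun i j => by
    rw [hr'', hr']
    split_ifs
    · rw [one_smul]
      exact LinearMap.baseChange_one _ _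
    · rw [zero_smul]
      exact LinearMap.baseChange_zero
  -- The Brauer characters of the possible composition factors of the extension of `S i`.
  let 𝒯 : ι → Set (regularElements K G → ℂ) := fun i => {φ | ∃ T : FDRep (AlgebraicClosure K) G,
    IsIrreducible T.ρ ∧ (∀ j, asAlgebraHom T.ρ (r' j) =
      (if i = j then 1 else 0 : AlgebraicClosure K) • 1) ∧ φ = closureBrauer ξ ω T}
  have hmem : ∀ i, closureBrauer ξ ω (repBaseChange (S i)) ∈ Submodule.span ℂ (𝒯 i) := by
    intro i
    refine Submodule.span_mono ?_ (closureBrauer_mem_span hξ hω (repBaseChange (S i)))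
    rintro _ ⟨T, hT, hc, rfl⟩
    exact ⟨T, hT, fun j => hc _ _ (hact j i), rfl⟩
  -- Distinct Brauer characters of irreducible representations form a linearly independent family.
  let Ω : Type _ := {φ : regularElements K G → ℂ // ∃ T : FDRep (AlgebraicClosure K) G,
    IsIrreducible T.ρ ∧ φ = closureBrauer ξ ω T}
  have hΩ : LinearIndependent ℂ (fun φ : Ω => φ.1) := by
    rw [linearIndependent_iff_finset_linearIndependent]
    intro s
    choose T hT hφ using fun φ : Ω => φ.2
    have := linearIndependent_closureBrauer hξ hω (fun φ : s => T φ.1) (fun φ => hT φ.1)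
      (fun φ ψ hne => ⟨fun i => hne (Subtype.ext (Subtype.ext (by
        rw [hφ φ.1, hφ ψ.1, closureBrauer_iso i])))⟩)
    convert this using 2 with φ
    exact hφ φ.1
  -- `r' i` acts as the identity on the composition factors for `i` and as zero on those for `j`, so
  -- these are not isomorphic and their Brauer characters differ.
  have hdisj : ∀ i j, i ≠ j → Disjoint (𝒯 i) (𝒯 j) := by
    intro i j hij
    rw [Set.disjoint_left]
    rintro φ ⟨T, hT, hTr, rfl⟩ ⟨T', hT', hTr', h⟩
    have hnt : ∀ T : FDRep (AlgebraicClosure K) G, IsIrreducible T.ρ → Nontrivial T := by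
      intro T hT
      have := (irreducible_iff_isSimpleModule_asModule _).1 hT
      exact IsSimpleModule.nontrivial (MonoidAlgebra (AlgebraicClosure K) G) (asModule T.ρ)
    have hiso : IsEmpty (T ≅ T') := by
      refine ⟨fun f => ?_⟩
      have := hnt T hT
      obtain ⟨x, hx⟩ := exists_ne (0 : T)
      have h1 := repHomToLinear_asAlgebraHom f.hom (r' i) x
      rw [hTr, hTr', if_pos rfl, if_neg hij.symm] at h1
      simp only [one_smul, zero_smul, Module.End.one_apply, LinearMap.zero_apply] at h1
      have h2 : repHomToLinear f.inv (repHomToLinear f.hom x) = x :=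
        (FDRep.isoToLinearEquiv f).symm_apply_apply x
      rw [h1, map_zero] at h2
      exact hx h2.symm
    have hli := linearIndependent_closureBrauer hξ hω (fun b : Bool => cond b T T')
      (fun b => by cases b <;> assumption) (by
        intro b b' hb
        cases b <;> cases b'
        · exact (hb rfl).elim
        · exact ⟨fun f => hiso.false f.symm⟩
        · exact hiso
        · exact (hb rfl).elim)
    have := hli.injective (a₁ := true) (a₂ := false) h
    simp at this
  -- The sets `𝒯 i` are disjoint subsets of one linearly independent family.
  have hind : iSupIndep fun i => Submodule.span ℂ (𝒯 i) := by
    intro i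
    have h1 : ∀ i, 𝒯 i = (fun φ : Ω => φ.1) '' {φ | φ.1 ∈ 𝒯 i} := by
      intro i
      ext φ
      constructor
      · rintro ⟨T, hT, hTr, rfl⟩
        exact ⟨⟨_, T, hT, rfl⟩, ⟨T, hT, hTr, rfl⟩, rfl⟩
      · rintro ⟨φ, h, rfl⟩
        exact h
    have h2 : (⨆ j, ⨆ (_ : j ≠ i), Submodule.span ℂ (𝒯 j)) =
        Submodule.span ℂ ((fun φ : Ω => φ.1) '' {φ | ∃ j, j ≠ i ∧ φ.1 ∈ 𝒯 j}) := by
      have : (fun φ : Ω => φ.1) '' {φ | ∃ j, j ≠ i ∧ φ.1 ∈ 𝒯 j} = ⋃ j, ⋃ (_ : j ≠ i), 𝒯 j := by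
        ext φ
        simp only [Set.mem_image, Set.mem_ofPred_eq, Set.mem_iUnion, exists_prop]
        constructor
        · rintro ⟨φ, ⟨j, hj, h⟩, rfl⟩
          exact ⟨j, hj, h⟩
        · rintro ⟨j, hj, T, hT, hTr, rfl⟩
          exact ⟨⟨_, T, hT, rfl⟩, ⟨j, hj, T, hT, hTr, rfl⟩, rfl⟩
      rw [this]
      simp only [Submodule.span_iUnion]
    change Disjoint (Submodule.span ℂ (𝒯 i)) _
    rw [h2, h1 i]
    refine hΩ.disjoint_span_image (Set.disjoint_left.2 ?_)
    rintro φ h3 ⟨j, hj, h4⟩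
    exact Set.disjoint_left.1 (hdisj i j hj.symm) h3 h4
  refine hind.linearIndependent _ hmem fun i h0 => ?_
  -- The value of a Brauer character at `1` is the dimension.
  have h1 := congrFun h0 ⟨1, fun h => ?_⟩
  · rw [closureBrauer_repBaseChange, brauerCharacter_eq_brauerLift] at h1
    rw [map_one, brauerLift_one hξ hω, Pi.zero_apply, Nat.cast_eq_zero] at h1
    have := (irreducible_iff_isSimpleModule_asModule _).1 (hS i)
    have : Nontrivial (S i) :=
      IsSimpleModule.nontrivial (MonoidAlgebra K G) (asModule (S i).ρ)
    exact (finrank_pos (R := K) (M := S i)).ne' h1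
  · rw [orderOf_one, Nat.dvd_one] at h
    exact CharP.ringChar_ne_one h

end LinearIndependence

/-! ### Injectivity of the Brauer character homomorphism -/

section Injectivity

open CategoryTheory Representation Module

variable {K : Type u} [Field K] {G : Type v} [Group G]

theorem grothendieckClass_add_of_exact {U V W : FDRep K G} {i : U ⟶ V} {q : V ⟶ W}
    (h : IsShortExactSeq i q) :
    grothendieckClass V = grothendieckClass U + grothendieckClass W := by
  have : Ideal.Quotient.mk (exactRelations K G) (greenClass V - greenClass U - greenClass W) = 0 :=
    Ideal.Quotient.eq_zero_iff_mem.2 (Ideal.subset_span ⟨U, V, W, i, q, h, rfl⟩)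
  rw [map_sub, map_sub, sub_sub, sub_eq_zero] at this
  exact this

theorem grothendieckClass_congr {V W : FDRep K G} (h : toSkeleton V = toSkeleton W) :
    grothendieckClass V = grothendieckClass W := by
  unfold grothendieckClass greenClass greenRingClass
  rw [h]

theorem span_grothendieckClass :
    Submodule.span ℂ (Set.range (grothendieckClass : FDRep K G → GrothendieckAlgebra K G)) = ⊤ := by
  refine eq_top_iff.2 fun x _ => ?_
  obtain ⟨y, rfl⟩ := Ideal.Quotient.mk_surjective x
  change TensorProduct ℤ ℂ (GreenRing K G) at y
  induction y using TensorProduct.induction_on with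
  | zero => exact zero_mem _
  | add a b ha hb => exact add_mem (ha trivial) (hb trivial)
  | tmul c y =>
    obtain ⟨y, rfl⟩ := Ideal.Quotient.mk_surjective y
    induction y using MonoidAlgebra.induction_linear with
    | zero =>
      rw [map_zero]
      erw [TensorProduct.tmul_zero]
      exact zero_mem _
    | add a b ha hb =>
      rw [map_add]
      erw [TensorProduct.tmul_add]
      exact add_mem (ha trivial) (hb trivial)
    | single s n =>
      have : (Ideal.Quotient.mk (exactRelations K G)) (c ⊗ₜ[ℤ]
          (Ideal.Quotient.mk (greenRelations K G)) (MonoidAlgebra.single s n)) =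
          (c * n) • grothendieckClass ((fromSkeleton _).obj s) := by
        have h1 : MonoidAlgebra.single s n =
            n • MonoidAlgebra.of ℤ _ (toSkeleton ((fromSkeleton (FDRep K G)).obj s)) := by
          rw [toSkeleton_fromSkeleton_obj, MonoidAlgebra.of_apply, MonoidAlgebra.smul_single,
            smul_eq_mul, mul_one]
        have h2 : (c ⊗ₜ[ℤ] (Ideal.Quotient.mk (greenRelations K G))
            (n • MonoidAlgebra.of ℤ _ (toSkeleton ((fromSkeleton (FDRep K G)).obj s))) :
              TensorProduct ℤ ℂ (GreenRing K G)) = (c * n) • ((1 : ℂ) ⊗ₜ[ℤ]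
                greenRingClass ((fromSkeleton (FDRep K G)).obj s)) := by
          rw [map_zsmul, TensorProduct.smul_tmul', smul_eq_mul, mul_one, mul_comm, ← zsmul_eq_mul,
            TensorProduct.smul_tmul]
          rfl
        rw [h1]
        exact congrArg (Ideal.Quotient.mk (exactRelations K G)) h2
      rw [this]
      exact Submodule.smul_mem _ _ (Submodule.subset_span ⟨_, rfl⟩)

/-- The isomorphism classes of irreducible representations. -/
def IrredClass (K : Type u) [Field K] (G : Type v) [Group G] : Type _ :=
  {s : RepClass K G // ∃ V : FDRep K G, IsIrreducible V.ρ ∧ toSkeleton V = s}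

/-- A representation in an isomorphism class of irreducible representations. -/
def IrredClass.rep (s : IrredClass K G) : FDRep K G := s.2.choose

theorem IrredClass.isIrreducible_rep (s : IrredClass K G) : IsIrreducible s.rep.ρ :=
  s.2.choose_spec.1

theorem IrredClass.toSkeleton_rep (s : IrredClass K G) : toSkeleton s.rep = s.1 :=
  s.2.choose_spec.2

/-- Every module has a composition series, so the classes of irreducible modules span. -/
theorem span_grothendieckClass_irred :
    Submodule.span ℂ (Set.range fun s : IrredClass K G => grothendieckClass s.rep) = ⊤ := by
  rw [← top_le_iff, ← span_grothendieckClass, Submodule.span_le]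
  rintro _ ⟨V, rfl⟩
  induction V using FDRep.induction_irreducible with
  | zero V h =>
    -- `0 → V → V → V → 0` is exact.
    have hz : grothendieckClass V = grothendieckClass V + grothendieckClass V :=
      grothendieckClass_add_of_exact (i := 𝟙 V) (q := 𝟙 V)
        ⟨Function.injective_of_subsingleton _, fun x => ⟨fun _ => ⟨x, Subsingleton.elim _ _⟩,
          fun _ => Subsingleton.elim _ _⟩, fun x => ⟨x, Subsingleton.elim _ _⟩⟩
    rw [left_eq_add.1 hz]
    exact zero_mem _
  | irred V h =>
    let s : IrredClass K G := ⟨toSkeleton V, V, h, rfl⟩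
    exact Submodule.subset_span ⟨s, grothendieckClass_congr s.toSkeleton_rep⟩
  | ext U V W i q h hU hW =>
    rw [grothendieckClass_add_of_exact h]
    exact add_mem hU hW

variable [Finite G] {ξ : AlgebraicClosure K} {ω : ℂ}

/-- The classes of irreducible modules span, and their Brauer characters are linearly
independent. -/
theorem brauerHom_injective (hξ : IsPrimitiveRoot ξ (regularExponent K G))
    (hω : IsPrimitiveRoot ω (regularExponent K G)) : Function.Injective (brauerHom hξ hω) := by
  have hli : LinearIndependent ℂ fun s : IrredClass K G =>
      brauerHom hξ hω (grothendieckClass s.rep) := by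
    rw [linearIndependent_iff_finset_linearIndependent]
    intro t
    let r : RegularClassFunctions K G →ₗ[ℂ] (regularElements K G → ℂ) :=
      { toFun := fun f => f.1
        map_add' := fun _ _ => rfl
        map_smul' := fun _ _ => rfl }
    refine LinearIndependent.of_comp r ?_
    have := linearIndependent_brauerCharacter hξ hω (fun s : t => s.1.rep)
      (fun s => s.1.isIrreducible_rep) (fun s s' hne => ⟨fun i => hne (Subtype.ext (Subtype.ext (by
        rw [← s.1.toSkeleton_rep, ← s'.1.toSkeleton_rep]
        exact congr_toSkeleton_of_iso i)))⟩)
    convert this using 2 with s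
    exact congrArg Subtype.val (brauerHom_grothendieckClass hξ hω s.1.rep)
  rw [injective_iff_map_eq_zero]
  intro x hx
  have hxs : x ∈ Submodule.span ℂ (Set.range fun s : IrredClass K G => grothendieckClass s.rep) := by
    rw [span_grothendieckClass_irred]
    trivial
  obtain ⟨l, rfl⟩ := (Finsupp.mem_span_range_iff_exists_finsupp).1 hxs
  have : l = 0 := by
    refine linearIndependent_iff.1 hli l ?_
    rw [← hx, Finsupp.linearCombination_apply, Finsupp.sum, Finsupp.sum, map_sum]
    simp only [map_smul]
  rw [this, Finsupp.sum_zero_index]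

end Injectivity

/-! ### The special `λ`-ring structure -/

section Structure

open CategoryTheory Representation Module NewtonSeries PowerSeries

variable {K : Type u} [Field K] {G : Type v} [Group G]

/-- The operation `Ψ ^ n` as an algebra homomorphism. -/
def classPsiHom (n : ℕ) : RegularClassFunctions K G →ₐ[ℂ] RegularClassFunctions K G where
  toFun := classPsi n
  map_one' := rfl
  map_mul' _ _ := rfl
  map_zero' := rfl
  map_add' _ _ := rfl
  commutes' _ := rfl

theorem classPsi_classPsi (m n : ℕ) (f : RegularClassFunctions K G) :
    classPsi m (classPsi n f) = classPsi (m * n) f := by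
  refine Subtype.ext (funext fun a => ?_)
  exact congrArg f.1 (Subtype.ext (pow_mul (a : G) m n).symm)

theorem classPsi_one (f : RegularClassFunctions K G) : classPsi 1 f = f := by
  refine Subtype.ext (funext fun a => ?_)
  exact congrArg f.1 (Subtype.ext (pow_one (a : G)))

/-- The series `∑ [Λ^n V] t ^ n`. -/
def exteriorSeries (V : FDRep K G) : PowerSeries (GrothendieckAlgebra K G) :=
  PowerSeries.mk fun n => grothendieckClass (repExterior n V)

variable [Finite G] {ξ : AlgebraicClosure K} {ω : ℂ}

/-- The value of the Brauer character homomorphism at a regular element. -/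
def brauerEval (hξ : IsPrimitiveRoot ξ (regularExponent K G))
    (hω : IsPrimitiveRoot ω (regularExponent K G)) (a : regularElements K G) :
    GrothendieckAlgebra K G →ₐ[ℂ] ℂ :=
  (Pi.evalAlgHom ℂ (fun _ : regularElements K G => ℂ) a).comp
    ((RegularClassFunctions K G).val.comp (brauerHom hξ hω))

theorem brauerEval_apply (hξ : IsPrimitiveRoot ξ (regularExponent K G))
    (hω : IsPrimitiveRoot ω (regularExponent K G)) (a : regularElements K G)
    (x : GrothendieckAlgebra K G) :
    brauerEval hξ hω a x = (brauerHom hξ hω x).1 a := rfl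

theorem eq_of_brauerEval_eq (hξ : IsPrimitiveRoot ξ (regularExponent K G))
    (hω : IsPrimitiveRoot ω (regularExponent K G)) {x y : GrothendieckAlgebra K G}
    (h : ∀ a, brauerEval hξ hω a x = brauerEval hξ hω a y) : x = y :=
  brauerHom_injective hξ hω (Subtype.ext (funext h))

/-- Evaluated at a regular element, the series of exterior powers has the values of the Brauer
character at the powers of that element as power sums. -/
theorem brauerEval_exteriorSeries (hξ : IsPrimitiveRoot ξ (regularExponent K G))
    (hω : IsPrimitiveRoot ω (regularExponent K G)) (V : FDRep K G) (a : regularElements K G) :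
    PowerSeries.map (brauerEval hξ hω a).toRingHom (exteriorSeries V) =
      ofPowerSums fun k => (classPsi k (brauerHom hξ hω (grothendieckClass V))).1 a := by
  obtain ⟨d, w, hw, hw'⟩ :=
    exists_brauerLift_pow_exteriorPower hξ hω (rho_pow_regularExponent V a.2)
  ext n
  have h1 : (fun k => (classPsi k (brauerHom hξ hω (grothendieckClass V))).1 a) =
      fun k => ∑ i, w i ^ k := by
    funext k
    rw [← hw, ← map_pow, brauerHom_grothendieckClass]
    rfl
  rw [h1, coeff_ofPowerSums_sum, coeff_prod_one_add_C_mul_X, ← hw', coeff_map, exteriorSeries,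
    coeff_mk]
  change brauerEval hξ hω a _ = _
  rw [brauerEval_apply, brauerHom_grothendieckClass]
  rfl

theorem constantCoeff_exteriorSeries (hξ : IsPrimitiveRoot ξ (regularExponent K G))
    (hω : IsPrimitiveRoot ω (regularExponent K G)) (V : FDRep K G) :
    constantCoeff (exteriorSeries V) = 1 := by
  refine eq_of_brauerEval_eq hξ hω fun a => ?_
  have h := congrArg (coeff 0) (brauerEval_exteriorSeries hξ hω V a)
  rw [coeff_map, coeff_zero_eq_constantCoeff_apply, coeff_zero_eq_constantCoeff_apply,
    constantCoeff_ofPowerSums] at h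
  rw [map_one]
  exact h

theorem brauerHom_powerSum_exteriorSeries (hξ : IsPrimitiveRoot ξ (regularExponent K G))
    (hω : IsPrimitiveRoot ω (regularExponent K G)) (V : FDRep K G) {n : ℕ} (hn : 1 ≤ n) :
    brauerHom hξ hω (powerSum (exteriorSeries V) n) =
      classPsi n (brauerHom hξ hω (grothendieckClass V)) := by
  refine Subtype.ext (funext fun a => ?_)
  have h := map_powerSum (brauerEval hξ hω a).toRingHom (constantCoeff_exteriorSeries hξ hω V) hn
  rw [brauerEval_exteriorSeries, powerSum_ofPowerSums _ hn] at h
  exact h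

/-- The image of the Brauer character homomorphism is stable under the operations `Ψ ^ n`, since
power sums are integral polynomials in elementary symmetric functions. -/
theorem classPsi_mem_range (hξ : IsPrimitiveRoot ξ (regularExponent K G))
    (hω : IsPrimitiveRoot ω (regularExponent K G)) {n : ℕ} (hn : 1 ≤ n)
    (x : GrothendieckAlgebra K G) :
    classPsi n (brauerHom hξ hω x) ∈ (brauerHom hξ hω).range := by
  let S : Submodule ℂ (GrothendieckAlgebra K G) :=
    (Subalgebra.toSubmodule (brauerHom hξ hω).range).comap
      ((classPsiHom n).comp (brauerHom hξ hω)).toLinearMap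
  have hS : S = ⊤ := by
    rw [← top_le_iff, ← span_grothendieckClass, Submodule.span_le]
    rintro _ ⟨V, rfl⟩
    exact ⟨_, brauerHom_powerSum_exteriorSeries hξ hω V hn⟩
  have : x ∈ S := hS ▸ Submodule.mem_top
  exact this

/-- The operation `Ψ ^ n` transported to the Grothendieck algebra; nothing is claimed for
`n = 0`. -/
theorem exists_adams (hξ : IsPrimitiveRoot ξ (regularExponent K G))
    (hω : IsPrimitiveRoot ω (regularExponent K G)) (n : ℕ) :
    ∃ Ψ : GrothendieckAlgebra K G →ₐ[ℂ] GrothendieckAlgebra K G,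
      1 ≤ n → ∀ x, brauerHom hξ hω (Ψ x) = classPsi n (brauerHom hξ hω x) := by
  by_cases hn : 1 ≤ n
  · let e := AlgEquiv.ofInjective (brauerHom hξ hω) (brauerHom_injective hξ hω)
    refine ⟨e.symm.toAlgHom.comp (((classPsiHom n).comp (brauerHom hξ hω)).codRestrict _
      (classPsi_mem_range hξ hω hn)), fun _ x => ?_⟩
    exact congrArg Subtype.val (e.apply_symm_apply _)
  · exact ⟨AlgHom.id ℂ _, fun h => (hn h).elim⟩

/-- The characteristic does not divide the least common multiple of the orders of the regular
elements, so primitive roots of unity of that order exist. -/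
theorem exists_isPrimitiveRoot_regularExponent :
    ∃ ξ : AlgebraicClosure K, IsPrimitiveRoot ξ (regularExponent K G) := by
  have h : ((regularExponent K G : ℕ) : K) ≠ 0 := by
    rw [Ne, ringChar.spec]
    intro hdvd
    by_cases h0 : ringChar K = 0
    · rw [h0, zero_dvd_iff] at hdvd
      exact NeZero.ne _ hdvd
    · have hp := (CharP.char_prime_of_ne_zero K h0).prime
      have : regularExponent K G ∣
          ∏ g ∈ (Set.toFinite (regularElements K G)).toFinset, orderOf g :=
        Finset.lcm_dvd fun g hg => Finset.dvd_prod_of_mem _ hg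
      obtain ⟨g, hg, hdvd⟩ := (hp.dvd_finsetProd_iff _).1 (hdvd.trans this)
      exact (Set.Finite.mem_toFinset _).1 hg hdvd
  have : NeZero ((regularExponent K G : ℕ) : AlgebraicClosure K) := ⟨by
    rw [← map_natCast (algebraMap K (AlgebraicClosure K))]
    exact (map_ne_zero _).2 h⟩
  exact HasEnoughRootsOfUnity.exists_primitiveRoot _ _

end Structure

theorem mainTheorem10 (K : Type u) [Field K] (G : Type v) [Group G] [Finite G] :
    ∃ L : LambdaRing (GrothendieckAlgebra K G),
      L.IsSpecial ∧
      (∀ (n : ℕ) (V : FDRep K G),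
        L.lam n (grothendieckClass V) = grothendieckClass (repExterior n V)) ∧
      ∀ (ξ : AlgebraicClosure K) (ω : ℂ),
        IsPrimitiveRoot ξ (regularExponent K G) → IsPrimitiveRoot ω (regularExponent K G) →
        ∃ ch : GrothendieckAlgebra K G →ₐ[ℂ] RegularClassFunctions K G,
          (∀ (V : FDRep K G) (a : regularElements K G),
            (ch (grothendieckClass V) : regularElements K G → ℂ) a = brauerCharacter ξ ω V a) ∧
          Function.Injective ch ∧
          (∀ n : ℕ, 1 ≤ n → ∀ x, ch (L.adams n x) = classPsi n (ch x)) ∧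
          ∀ L' : LambdaRing (GrothendieckAlgebra K G), L'.IsSpecial →
            (∀ n : ℕ, 1 ≤ n → ∀ x, ch (L'.adams n x) = classPsi n (ch x)) → L' = L := by
  obtain ⟨ξ₀, hξ₀⟩ := exists_isPrimitiveRoot_regularExponent (K := K) (G := G)
  have hω₀ := Complex.isPrimitiveRoot_exp (regularExponent K G) (NeZero.ne _)
  -- The structure is built with one choice of roots of unity; that it has the required Adams
  -- operations for every other choice follows from its values on classes of modules.
  choose Ψ hΨ using exists_adams hξ₀ hω₀
  have hinj := brauerHom_injective hξ₀ hω₀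
  have h1 : ∀ x, (Ψ 1).toRingHom x = x := fun x =>
    hinj ((hΨ 1 le_rfl x).trans (classPsi_one _))
  have hmul : ∀ m n, 1 ≤ m → 1 ≤ n → ∀ x, (Ψ m).toRingHom ((Ψ n).toRingHom x) =
      (Ψ (m * n)).toRingHom x := fun m n hm hn x => by
    refine hinj ((hΨ m hm _).trans ?_)
    refine (congrArg (classPsi m) (hΨ n hn x)).trans ?_
    rw [classPsi_classPsi]
    exact (hΨ (m * n) (Nat.mul_pos hm hn) x).symm
  let L := LambdaRing.ofAdams (fun n => (Ψ n).toRingHom) h1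
  have hlam : ∀ (n : ℕ) (V : FDRep K G),
      L.lam n (grothendieckClass V) = grothendieckClass (repExterior n V) := by
    intro n V
    refine eq_of_brauerEval_eq hξ₀ hω₀ fun a => ?_
    have h := congrArg (PowerSeries.coeff n) (brauerEval_exteriorSeries hξ₀ hω₀ V a)
    rw [PowerSeries.coeff_map, exteriorSeries, PowerSeries.coeff_mk] at h
    refine Eq.trans ?_ h.symm
    refine (NewtonSeries.coeff_ofPowerSums_map (brauerEval hξ₀ hω₀ a).toRingHom _ n).trans ?_
    refine NewtonSeries.coeff_ofPowerSums_congr fun k hk _ => ?_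
    exact congrArg (fun f => f.1 a) (hΨ k hk (grothendieckClass V))
  refine ⟨L, ?_, hlam, fun ξ ω hξ hω => ⟨brauerHom hξ hω, ?_, brauerHom_injective hξ hω, ?_⟩⟩
  · refine LambdaRing.isSpecial_ofAdams (fun x hx => ?_) _ h1 hmul
    exact eq_of_brauerEval_eq hξ₀ hω₀ fun a => by rw [hx, map_zero]
  · intro V a
    rw [brauerHom_grothendieckClass]
    rfl
  · have hadams : ∀ n : ℕ, 1 ≤ n → ∀ x,
        brauerHom hξ hω (L.adams n x) = classPsi n (brauerHom hξ hω x) := by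
      intro n hn x
      rw [LambdaRing.adams_ofAdams (fun n => (Ψ n).toRingHom) h1 hn]
      -- Both sides are linear in `x`, so it suffices to consider the classes of modules, where
      -- the Adams operations are determined by the exterior powers.
      have hV : ∀ V : FDRep K G, brauerHom hξ hω (Ψ n (grothendieckClass V)) =
          classPsi n (brauerHom hξ hω (grothendieckClass V)) := by
        intro V
        rw [← brauerHom_powerSum_exteriorSeries hξ hω V hn]
        congr 1
        refine (LambdaRing.adams_ofAdams (fun n => (Ψ n).toRingHom) h1 hn (grothendieckClass V)).symm.trans ?_
        rw [LambdaRing.adams_eq_powerSum]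
        congr 1
        ext m
        simp only [LambdaRing.lamT, exteriorSeries, PowerSeries.coeff_mk]
        exact hlam m V
      have heq : ((brauerHom hξ hω).comp (Ψ n)).toLinearMap =
          ((classPsiHom n).comp (brauerHom hξ hω)).toLinearMap :=
        LinearMap.ext_on span_grothendieckClass (by
          rintro _ ⟨V, rfl⟩
          exact hV V)
      exact LinearMap.congr_fun heq x
    refine ⟨hadams, fun L' _ h' => LambdaRing.eq_of_adams_eq fun n hn x => ?_⟩
    exact brauerHom_injective hξ hω ((h' n hn x).trans (hadams n hn x).symm)

end
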